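/- Let $G$ be a compact connected Lie group with Lie algebra $\mathfrak g$, let $\mu$ be its Haar probability measure, let $V$ be a finite-dimensional complex inner product space and $\phi : G \to \mathcal U(V)$ a (smooth) unitary representation with differential $d\phi : \mathfrak g \to \mathfrak u(V)$; write $U_g = \phi(g)$. Let $o, h \in \mathfrak g$, define operators $O$ and $H$ on $V$ by $iO = d\phi(o)$ and $H = d\phi(h)$, and let $\rho$ be a density operator on $V$ (positive semidefinite, trace one). For $g^+, g^- \in G$ put $$\partial\langle O\rangle_\rho(g^+,g^-) = \operatorname{Tr}\bigl( U_{g^-}^\dagger\, \rho\, U_{g^-}\, [H,\, U_{g^+} O U_{g^+}^\dagger] \bigr), \qquad \mathrm{GradVar} = \operatorname{Var}_{(g^+,g^-)\sim \mu\otimes\mu}\bigl[\partial\langle O\rangle_\rho\bigr];$$ the quantity $\partial\langle O\rangle_\rho$ is real. Then $\mathfrak g$ is the direct sum $\mathfrak g = \bigoplus_\alpha \mathfrak g_\alpha \oplus \mathfrak c$ of finitely many simple ideals $\mathfrak g_\alpha$ and its center $\mathfrak c$, and for every such decomposition $$\mathrm{GradVar} = \sum_\alpha \frac{\|H_{\mathfrak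 g_\alpha}\|_{\mathrm K}^2\, \|O_{\mathfrak g_\alpha}\|_{\mathrm F}^2\, \|\rho_{\mathfrak g_\alpha}\|_{\mathrm F}^2}{d_{\mathfrak g_\alpha}^2}.$$ Here $d_{\mathfrak g_\alpha} = \dim_{\mathbb R} \mathfrak g_\alpha$; for a skew-Hermitian operator $X$, $X_{\mathfrak g_\alpha}$ is the orthogonal projection of $X$ onto the real subspace $d\phi(\mathfrak g_\alpha) \subset \mathfrak u(V)$ with respect to the Frobenius inner product $\langle X, Y\rangle = \operatorname{Re}\operatorname{Tr}(X^\dagger Y)$, and for a Hermitian operator $A$, $A_{\mathfrak g_\alpha}$ is defined by $iA_{\mathfrak g_\alpha} = (iA)_{\mathfrak g_\alpha}$; $\|A\|_{\mathrm F}^2 = \operatorname{Tr}(A^\dagger A)$; and $\|X\|_{\mathrm K}^2 = -\operatorname{Tr}(\operatorname{ad}_X \circ \operatorname{ad}_X)$ is the Killing norm of an element $X$ of the Lie algebra $d\phi(\mathfrak g_\alpha)$. The center does not contribute to the variance: adding to $H$, $O$ and $\rho$ operators $H_c$, $O_c$, $\rho_c$ with $H_c,\, iO_c,\, i\rho_c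 \in d\phi(\mathfrak c)$ leaves $\mathrm{GradVar}$ unchanged. -/

import Mathlib

open MeasureTheory ProbabilityTheory VectorField
open scoped Manifold ContDiff

attribute [local instance 100] LieRing.ofAssociativeRing

namespace LieGradient

/-- A smooth Lie group is regular enough for Mathlib's Lie algebra structure on its tangent
space at the identity. -/
instance lieGroup_minSmoothness_three {E : Type*} [NormedAddCommGroup E] [NormedSpace ℝ E]
    {G : Type*} [TopologicalSpace G] [ChartedSpace E G] [Group G] [LieGroup 𝓘(ℝ, E) ∞ G] :
    LieGroup 𝓘(ℝ, E) (minSmoothness ℝ 3) G :=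
  LieGroup.of_le (n := ∞) (by
    rw [minSmoothness_of_isRCLikeNormedField]; exact ENat.LEInfty.out)

/-- The derivative at `1` of a smooth multiplicative map into an associative algebra sends the
Lie bracket (of left-invariant vector fields) to the commutator. -/
theorem mfderiv_hom_lie
    {E : Type*} [NormedAddCommGroup E] [NormedSpace ℝ E] [FiniteDimensional ℝ E]
    {G : Type*} [TopologicalSpace G] [ChartedSpace E G] [Group G] [LieGroup 𝓘(ℝ, E) ∞ G]
    {A : Type*} [NormedRing A] [NormedAlgebra ℝ A] (f : G → A) (hmul : ∀ g h, f (g * h) = f g * f h)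
    (hone : f 1 = 1) (hf : ContMDiff 𝓘(ℝ, E) 𝓘(ℝ, A) ∞ f) (D : GroupLieAlgebra 𝓘(ℝ, E) G →L[ℝ] A)
    (hD : D = mfderiv 𝓘(ℝ, E) 𝓘(ℝ, A) f 1)
    (x y : GroupLieAlgebra 𝓘(ℝ, E) G) :
    D ⁅x, y⁆ = D x * D y - D y * D x := by
  have hmd : MDifferentiable 𝓘(ℝ, E) 𝓘(ℝ, A) f := hf.mdifferentiable (by simp)
  have : IsManifold 𝓘(ℝ, E) 2 G := IsManifold.of_le (n := ∞) ENat.LEInfty.out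
  have : IsManifold 𝓘(ℝ, E) 1 G := IsManifold.of_le (n := ∞) ENat.LEInfty.out
  -- the invariant fields are carried to right multiplication by `D v`
  have key : ∀ (v : GroupLieAlgebra 𝓘(ℝ, E) G) (g : G),
      (mfderiv 𝓘(ℝ, E) 𝓘(ℝ, A) f g (mulInvariantVectorField v g) : A) = f g * D v := by
    intro v g
    have h1 : HasMFDerivAt 𝓘(ℝ, E) 𝓘(ℝ, E) (fun h : G => g * h) 1
        (mfderiv 𝓘(ℝ, E) 𝓘(ℝ, E) (fun h : G => g * h) 1) :=
      ((contMDiff_mul_left (I := 𝓘(ℝ, E)) (n := ∞) (a := g)).mdifferentiable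
        (by simp) 1).hasMFDerivAt
    have h2 : HasMFDerivAt 𝓘(ℝ, E) 𝓘(ℝ, A) f (g * 1) (mfderiv 𝓘(ℝ, E) 𝓘(ℝ, A) f (g * 1)) :=
      (hmd (g * 1)).hasMFDerivAt
    have h3 := HasMFDerivAt.comp (x := (1 : G)) (f := fun h : G => g * h) (g := f) h2 h1
    have h4 : HasMFDerivAt 𝓘(ℝ, E) 𝓘(ℝ, A) (f ∘ fun h : G => g * h) 1
        ((ContinuousLinearMap.mul ℝ A (f g)).comp D) := by
      have h5 : HasMFDerivAt 𝓘(ℝ, E) 𝓘(ℝ, A) f 1 D := by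
        rw [hD]; exact (hmd 1).hasMFDerivAt
      have h6 : HasMFDerivAt 𝓘(ℝ, A) 𝓘(ℝ, A) (ContinuousLinearMap.mul ℝ A (f g)) (f 1)
          (ContinuousLinearMap.mul ℝ A (f g)) :=
        (ContinuousLinearMap.mul ℝ A (f g)).hasFDerivAt.hasMFDerivAt
      have h7 := HasMFDerivAt.comp (x := (1 : G)) (f := f) h6 h5
      have : (f ∘ fun h : G => g * h) = (ContinuousLinearMap.mul ℝ A (f g)) ∘ f := by
        funext h; simp [hmul]
      rw [this]; exact h7
    have h8 := hasMFDerivAt_unique h3 h4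
    have h9 := congrArg (fun L : E →L[ℝ] A => L v) h8
    have hg : g * 1 = g := mul_one g
    have h10 : (mfderiv 𝓘(ℝ, E) 𝓘(ℝ, A) f (g * 1) (mulInvariantVectorField v g) : A)
      = f g * D v := h9
    rw [hg] at h10
    exact h10
  set e := extChartAt 𝓘(ℝ, E) (1 : G) with he
  set Fv : GroupLieAlgebra 𝓘(ℝ, E) G → E → E := fun v =>
    mpullbackWithin 𝓘(ℝ, E) 𝓘(ℝ, E) e.symm (mulInvariantVectorField v) (Set.range 𝓘(ℝ, E))
    with hFv
  set F : E → A := fun z => f (e.symm z) with hF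
  have htgt : e.target ∈ nhds (e 1) := extChartAt_target_mem_nhds (I := 𝓘(ℝ, E)) (1 : G)
  have he1 : e.symm (e 1) = 1 := extChartAt_to_inv (I := 𝓘(ℝ, E)) (1 : G)
  have hmem : e 1 ∈ e.target := mem_extChartAt_target (I := 𝓘(ℝ, E)) (1 : G)
  have hchain : ∀ z ∈ e.target, fderiv ℝ F z =
      (mfderiv 𝓘(ℝ, E) 𝓘(ℝ, A) f (e.symm z) : E →L[ℝ] A).comp
        (mfderivWithin 𝓘(ℝ, E) 𝓘(ℝ, E) e.symm (Set.range 𝓘(ℝ, E)) z : E →L[ℝ] E) := by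
    intro z hz
    have h1 : MDifferentiableWithinAt 𝓘(ℝ, E) 𝓘(ℝ, E) e.symm (Set.range 𝓘(ℝ, E)) z :=
      mdifferentiableWithinAt_extChartAt_symm hz
    have h2 := h1.hasMFDerivWithinAt
    have h3 := (hmd (e.symm z)).hasMFDerivAt
    have h4 := HasMFDerivAt.comp_hasMFDerivWithinAt (x := z) h3 h2
    have h5 : HasMFDerivAt 𝓘(ℝ, E) 𝓘(ℝ, A) F z
      ((mfderiv 𝓘(ℝ, E) 𝓘(ℝ, A) f (e.symm z) : E →L[ℝ] A).comp
        (mfderivWithin 𝓘(ℝ, E) 𝓘(ℝ, E) e.symm (Set.range 𝓘(ℝ, E)) z : E →L[ℝ] E)) := by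
      rw [← hasMFDerivWithinAt_univ]
      have : (Set.range 𝓘(ℝ, E)) = Set.univ := by simp
      rw [this] at h4 ⊢
      exact h4
    have h6 : HasFDerivAt F ((mfderiv 𝓘(ℝ, E) 𝓘(ℝ, A) f (e.symm z) : E →L[ℝ] A).comp
        (mfderivWithin 𝓘(ℝ, E) 𝓘(ℝ, E) e.symm (Set.range 𝓘(ℝ, E)) z : E →L[ℝ] E)) z :=
      hasMFDerivAt_iff_hasFDerivAt.1 h5
    exact HasFDerivAt.fderiv (𝕜 := ℝ) (E := E) (F := A) h6
  have hrel : ∀ v, ∀ z ∈ e.target, fderiv ℝ F z (Fv v z) = F z * D v := by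
    intro v z hz
    rw [hchain z hz, ← key v (e.symm z)]
    have hinv := isInvertible_mfderivWithin_extChartAt_symm (I := 𝓘(ℝ, E)) (x := (1 : G)) hz
    have h1 : (mfderivWithin 𝓘(ℝ, E) 𝓘(ℝ, E) e.symm (Set.range 𝓘(ℝ, E)) z : E →L[ℝ] E)
        (Fv v z) = mulInvariantVectorField v (e.symm z) := by
      exact hinv.self_apply_inverse _
    exact congrArg (mfderiv 𝓘(ℝ, E) 𝓘(ℝ, A) f (e.symm z) : E →L[ℝ] A) h1
  have hFs : ContDiffAt ℝ 2 F (e 1) := by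
    have h1 : ContMDiffOn 𝓘(ℝ, E) 𝓘(ℝ, E) ∞ e.symm e.target := contMDiffOn_extChartAt_symm 1
    have h2 : ContMDiffOn 𝓘(ℝ, E) 𝓘(ℝ, A) ∞ F e.target := hf.comp_contMDiffOn h1
    exact ((h2.contMDiffAt htgt).contDiffAt).of_le ENat.LEInfty.out
  have hVd : ∀ v, DifferentiableAt ℝ (Fv v) (e 1) := by
    intro v
    have h := MDifferentiableWithinAt.differentiableWithinAt_mpullbackWithin_vectorField
      (I := 𝓘(ℝ, E)) (s := Set.univ) (x := (1 : G)) (V := mulInvariantVectorField v)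
      (mdifferentiableAt_mulInvariantVectorField v).mdifferentiableWithinAt
    have hs : e.symm ⁻¹' Set.univ ∩ Set.range 𝓘(ℝ, E) = Set.univ := by simp
    have h' : DifferentiableWithinAt ℝ (Fv v)
      (e.symm ⁻¹' Set.univ ∩ Set.range 𝓘(ℝ, E)) (e 1) := h
    rw [hs] at h'
    exact differentiableWithinAt_univ.1 h'
  set b : E := lieBracket ℝ (Fv x) (Fv y) (e 1) with hb
  have hbr : D ⁅x, y⁆ = D b := by
    have hs : e.symm ⁻¹' Set.univ ∩ Set.range 𝓘(ℝ, E) = Set.univ := by simp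
    set w : E := lieBracketWithin ℝ (Fv x) (Fv y)
        (e.symm ⁻¹' Set.univ ∩ Set.range 𝓘(ℝ, E)) (e 1) with hw
    have h1 : w = b := by
      rw [hw, hs, lieBracketWithin_univ]
    have h2 : (mfderiv 𝓘(ℝ, E) 𝓘(ℝ, E) e (1 : G) : E →L[ℝ] E).inverse =
        ContinuousLinearMap.id ℝ E := by
      have h3 : (mfderiv 𝓘(ℝ, E) 𝓘(ℝ, E) e (1 : G) : E →L[ℝ] E) = ContinuousLinearMap.id ℝ E :=
        mfderiv_extChartAt_self
      rw [h3]
      exact ContinuousLinearMap.inverse_id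
    have h4 : (⁅x, y⁆ : GroupLieAlgebra 𝓘(ℝ, E) G) =
        (mfderiv 𝓘(ℝ, E) 𝓘(ℝ, E) e (1 : G) : E →L[ℝ] E).inverse w := rfl
    rw [h4, h1, h2]
    rfl
  have hF1 : F (e 1) = 1 := by simp [hF, he1, hone]
  have hD1 : fderiv ℝ F (e 1) = D := by
    have h1 : (mfderivWithin 𝓘(ℝ, E) 𝓘(ℝ, E) e.symm (Set.range 𝓘(ℝ, E)) (e 1) : E →L[ℝ] E)
        = (ContinuousLinearMap.id ℝ E : E →L[ℝ] E) := mfderivWithin_range_extChartAt_symm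
    rw [hchain _ hmem, he1, hD, h1]
    rfl
  have hFd : DifferentiableAt ℝ F (e 1) := hFs.differentiableAt (by simp)
  have hder : ∀ v, fderiv ℝ (fun z => fderiv ℝ F z (Fv v z)) (e 1) =
      ((ContinuousLinearMap.mul ℝ A).flip (D v)).comp D := by
    intro v
    have h : (fun z => fderiv ℝ F z (Fv v z)) =ᶠ[nhds (e 1)] fun z => F z * D v := by
      filter_upwards [htgt] with z hz using hrel v z hz
    have hFd' : HasFDerivAt F (D : E →L[ℝ] A) (e 1) := by
      rw [← hD1]; exact hFd.hasFDerivAt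
    have h2 := ((ContinuousLinearMap.mul ℝ A).flip (D v)).hasFDerivAt.comp (e 1) hFd'
    rw [h.fderiv_eq]
    exact h2.fderiv
  have hmain := fderiv_apply_lieBracket_of_isSymmSndFDerivAt (V := Fv x) (W := Fv y) hFs
    (hFs.isSymmSndFDerivAt (by simp)) (hVd y) (hVd x)
  have hev : ∀ v, D (Fv v (e 1)) = D v := by
    intro v
    have := hrel v (e 1) hmem
    rw [hD1, hF1, one_mul] at this
    exact this
  rw [hder, hder, hD1] at hmain
  rw [hbr]
  refine hmain.trans ?_
  change D (Fv x (e 1)) * D y - D (Fv y (e 1)) * D x = _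
  rw [hev, hev]

noncomputable section

/-! ### Operators on a finite-dimensional complex inner product space -/

section Operators

variable {V : Type*} [NormedAddCommGroup V] [InnerProductSpace ℂ V] [FiniteDimensional ℂ V]

/-- The trace of an operator on `V`. -/
def tr (A : V →L[ℂ] V) : ℂ := LinearMap.trace ℂ V (A : V →ₗ[ℂ] V)

/-- The real Frobenius inner product `Re Tr (A† B)`. -/
def frobeniusForm (V : Type*) [NormedAddCommGroup V] [InnerProductSpace ℂ V]
    [FiniteDimensional ℂ V] : LinearMap.BilinForm ℝ (V →L[ℂ] V) :=
  LinearMap.mk₂ ℝ (fun A B => (tr (star A * B)).re)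
    (fun A A' B => by simp [tr, add_mul])
    (fun c A B => by simp [tr])
    (fun A B B' => by simp [tr, mul_add])
    (fun c A B => by simp [tr])

/-- The squared Frobenius norm `‖A‖_F² = Tr (A† A)`. -/
def frobeniusSq (A : V →L[ℂ] V) : ℝ := frobeniusForm V A A

theorem frobeniusForm_eq_sum (A B : V →L[ℂ] V) :
    frobeniusForm V A B =
      ∑ i, (inner ℂ (A (stdOrthonormalBasis ℂ V i)) (B (stdOrthonormalBasis ℂ V i))).re := by
  change (LinearMap.trace ℂ V ((star A * B : V →L[ℂ] V) : V →ₗ[ℂ] V)).re = _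
  rw [LinearMap.trace_eq_sum_inner _ (stdOrthonormalBasis ℂ V), Complex.re_sum]
  refine Finset.sum_congr rfl fun i _ => ?_
  simp [ContinuousLinearMap.star_eq_adjoint, ContinuousLinearMap.adjoint_inner_right]

theorem isCompl_orthogonal_frobenius (W : Submodule ℝ (V →L[ℂ] V)) :
    IsCompl W ((frobeniusForm V).orthogonal W) := by
  have hsymm : ∀ A B : V →L[ℂ] V, frobeniusForm V A B = frobeniusForm V B A := fun A B => by
    simp only [frobeniusForm_eq_sum]
    exact Finset.sum_congr rfl fun i _ => inner_re_symm (𝕜 := ℂ) _ _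
  have hrefl : (frobeniusForm V).IsRefl := fun A B h => by rw [hsymm]; exact h
  rw [LinearMap.BilinForm.isCompl_orthogonal_iff_disjoint hrefl, Submodule.disjoint_def]
  intro A hA hA'
  have h0 : frobeniusForm V A A = 0 := hA' A hA
  rw [frobeniusForm_eq_sum] at h0
  have hnn : ∀ i ∈ Finset.univ, 0 ≤ (inner ℂ (A (stdOrthonormalBasis ℂ V i))
      (A (stdOrthonormalBasis ℂ V i))).re := fun i _ => inner_self_nonneg (𝕜 := ℂ)
  have h2 := (Finset.sum_eq_zero_iff_of_nonneg hnn).1 h0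
  have h1 : ∀ i, A (stdOrthonormalBasis ℂ V i) = 0 := fun i =>
    inner_self_eq_zero (𝕜 := ℂ).1 (by
      rw [← inner_self_ofReal_re (𝕜 := ℂ)]
      exact congrArg Complex.ofReal (h2 i (Finset.mem_univ i)))
  apply ContinuousLinearMap.coe_injective
  exact (stdOrthonormalBasis ℂ V).toBasis.ext fun i => by simpa using h1 i

/-- The orthogonal projection, for the Frobenius inner product, onto a real subspace `W` of
operators. -/
def frobeniusProj (W : Submodule ℝ (V →L[ℂ] V)) : (V →L[ℂ] V) →ₗ[ℝ] (V →L[ℂ] V) :=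
  W.projection _ (isCompl_orthogonal_frobenius W)

/-- The component `X_𝔴` of a (skew-Hermitian) operator `X` in a Lie algebra `𝔴` of operators,
as an element of `𝔴`. -/
def skewPart (𝔴 : LieSubalgebra ℝ (V →L[ℂ] V)) (X : V →L[ℂ] V) : 𝔴 :=
  ⟨frobeniusProj 𝔴.toSubmodule X, Submodule.projection_apply_mem _ X⟩

/-- The component `A_𝔴` of a Hermitian operator `A` along a Lie algebra `𝔴` of skew-Hermitian
operators: `i A_𝔴` is the orthogonal projection of `i A` onto `𝔴`. -/
def hermPart (𝔴 : LieSubalgebra ℝ (V →L[ℂ] V)) (A : V →L[ℂ] V) : V →L[ℂ] V :=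
  -Complex.I • frobeniusProj 𝔴.toSubmodule (Complex.I • A)

/-- The squared Killing norm `-Tr (ad_X ∘ ad_X)` of an element of a Lie algebra of operators. -/
def killingSq (𝔴 : LieSubalgebra ℝ (V →L[ℂ] V)) (X : 𝔴) : ℝ :=
  -killingForm ℝ 𝔴 X X

/-- Density operators: positive semidefinite with trace one. -/
def IsDensityOperator (ρ : V →L[ℂ] V) : Prop := ρ.IsPositive ∧ tr ρ = 1

end Operators

/-! ### Unitary representations and the abstracted gradient -/

section Representation

variable {E : Type*} [NormedAddCommGroup E] [NormedSpace ℝ E] [FiniteDimensional ℝ E]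
  {G : Type*} [TopologicalSpace G] [ChartedSpace E G] [Group G]
  {V : Type*} [NormedAddCommGroup V] [InnerProductSpace ℂ V] [FiniteDimensional ℂ V]

/-- Smoothness of a unitary representation, as a map into the operators on `V`. -/
def IsSmoothRep (E : Type*) [NormedAddCommGroup E] [NormedSpace ℝ E]
    {G : Type*} [TopologicalSpace G] [ChartedSpace E G] [Group G]
    {V : Type*} [NormedAddCommGroup V] [InnerProductSpace ℂ V] [FiniteDimensional ℂ V]
    (φ : G →* unitary (V →L[ℂ] V)) : Prop :=
  ContMDiff 𝓘(ℝ, E) 𝓘(ℝ, V →L[ℂ] V) ∞ (fun g : G => (φ g : V →L[ℂ] V))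

/-- The differential `dφ` at the identity of a smooth unitary representation `φ`, a homomorphism
of Lie algebras. -/
def dRep [LieGroup 𝓘(ℝ, E) ∞ G] (φ : G →* unitary (V →L[ℂ] V)) (hφ : IsSmoothRep E φ) :
    GroupLieAlgebra 𝓘(ℝ, E) G →ₗ⁅ℝ⁆ (V →L[ℂ] V) where
  toFun x := mfderiv 𝓘(ℝ, E) 𝓘(ℝ, V →L[ℂ] V) (fun g : G => (φ g : V →L[ℂ] V)) 1 x
  map_add' x y := map_add _ x y
  map_smul' c x := map_smul _ c x
  map_lie' {x y} :=
    mfderiv_hom_lie (fun g : G => (φ g : V →L[ℂ] V)) (fun g h => by simp) (by simp) hφ _ rfl x y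

/-- The Lie algebra of operators `dφ(𝔞)`, for an ideal `𝔞` of the Lie algebra of `G`. -/
def dRepIdeal [LieGroup 𝓘(ℝ, E) ∞ G] (φ : G →* unitary (V →L[ℂ] V)) (hφ : IsSmoothRep E φ)
    (𝔞 : LieIdeal ℝ (GroupLieAlgebra 𝓘(ℝ, E) G)) : LieSubalgebra ℝ (V →L[ℂ] V) :=
  (LieIdeal.toLieSubalgebra ℝ _ 𝔞).map (dRep φ hφ)

/-- The abstracted gradient `Tr (U_{g⁻}† A U_{g⁻} [H, U_{g⁺} O U_{g⁺}†])`, where `U_g = φ g`. -/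
def absGradient (φ : G →* unitary (V →L[ℂ] V)) (H O A : V →L[ℂ] V) (gp gm : G) : ℂ :=
  tr (star (φ gm : V →L[ℂ] V) * A * (φ gm : V →L[ℂ] V) *
    ⁅H, (φ gp : V →L[ℂ] V) * O * star (φ gp : V →L[ℂ] V)⁆)

/-- The variance of the (real-valued) abstracted gradient for independent `g⁺, g⁻ ∼ μ`. -/
def gradVar [MeasurableSpace G] (μ : Measure G) (φ : G →* unitary (V →L[ℂ] V))
    (H O A : V →L[ℂ] V) : ℝ :=
  variance (fun p : G × G => (absGradient φ H O A p.1 p.2).re) (μ.prod μ)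

end Representation

/-- `𝔤 = 𝔞 0 ⊕ ⋯ ⊕ 𝔞 (n - 1) ⊕ 𝔠` with simple ideals `𝔞 α` and `𝔠` the center of `𝔤`. -/
structure IsReductiveDecomposition {𝔤 : Type*} [LieRing 𝔤] [LieAlgebra ℝ 𝔤] {n : ℕ}
    (𝔞 : Fin n → LieIdeal ℝ 𝔤) : Prop where
  simple : ∀ α, LieAlgebra.IsSimple ℝ (𝔞 α)
  directSum : DirectSum.IsInternal fun j : Option (Fin n) =>
    j.elim (LieAlgebra.center ℝ 𝔤).toSubmodule fun α => (𝔞 α).toSubmodule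

end

end LieGradient

open LieGradient

set_option linter.unusedSectionVars false

/-! Multiplying `O` and `ρ` by `i` turns the gradient into the real Frobenius pairing of `g⁻¹(iρ)g`,
for `g = g⁻`, with `[H, g(iO)g⁻¹]`, for `g = g⁺`. Since `g(iO)g⁻¹` stays in `dφ(𝔤)`, the central
part of `H` drops out of the commutator. As `ad` of a skew-Hermitian operator is skew, the gradient
equals `⟨g⁺(iO)g⁺⁻¹, ∑ Z_α⟩`, where `Z_α = -[H_α, P_α(g⁻⁻¹(iρ)g⁻)]` lies in `dφ(𝔤_α)` and depends on
`g⁻` only; `P_α` is the Frobenius projection onto `dφ(𝔤_α)`.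

Integrate over `g⁺` with `g⁻` fixed. The first moment of `g(iO)g⁻¹` is an invariant linear form, so
it kills commutators, hence simple ideals: the mean is zero. The second moment is an invariant
symmetric bilinear form. It vanishes between different ideals, and on each `dφ(𝔤_α)` Schur's lemma
makes it a multiple of the Frobenius form. Taking a trace, and using that `P_α` commutes with
conjugation (`frobeniusProj_conjRep`, where connectedness enters), the multiple is `‖O_α‖² / d_α`
(`finrank_mul_secondMoment`). There remains the integral of `‖Z_α‖²` over `g⁻`; the same second
moment, contracted with `ad H_α` twice, gives `‖H_α‖_K² ‖ρ_α‖² / d_α`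
(`finrank_mul_integral_frobeniusSq_lie`). The formula needs `ρ` only Hermitian, and every projection
`P_α` kills the image of the center, which gives the last claim.

For the decomposition of `𝔤`, an inner product averaged over the adjoint action is invariant under
the bracket, because the derivative of `Ad` at `1` is `ad`; that fact is read off the second
derivative of the multiplication in a chart. Orthogonal complements of ideals are then ideals, so
`𝔤` is spanned by minimal ideals; the non-abelian ones are simple and the abelian ones central. -/

namespace LieGradient

/-! ### Lie algebras with an invariant inner product: reductive decomposition and Schur's lemma -/

section LieAlgebraForms

variable {𝔤 : Type*} [LieRing 𝔤] [LieAlgebra ℝ 𝔤] [FiniteDimensional ℝ 𝔤]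

theorem isCompl_orthogonal_of_pos (Φ : LinearMap.BilinForm ℝ 𝔤) (hs : ∀ x y, Φ x y = Φ y x)
    (hp : ∀ x, x ≠ 0 → 0 < Φ x x) (hinv : Φ.lieInvariant 𝔤) (I : LieIdeal ℝ 𝔤) :
    IsCompl I (LieAlgebra.InvariantForm.orthogonal Φ hinv I) := by
  have hrefl : Φ.IsRefl := fun x y h => by rw [hs]; exact h
  rw [← LieSubmodule.isCompl_toSubmodule, LieAlgebra.InvariantForm.orthogonal_toSubmodule,
    LinearMap.BilinForm.isCompl_orthogonal_iff_disjoint hrefl, Submodule.disjoint_def]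
  intro x hx hx'
  by_contra hne
  exact (hp x hne).ne' (hx' x hx)

/-- For `a` in `I`, `[a, x]` is again in `I`, so `[a, [a, x]] = 0`; by invariance `[a, x]` is then
orthogonal to itself. -/
theorem le_center_of_isLieAbelian (Φ : LinearMap.BilinForm ℝ 𝔤)
    (hp : ∀ x, x ≠ 0 → 0 < Φ x x) (hinv : Φ.lieInvariant 𝔤) (I : LieIdeal ℝ 𝔤)
    (hI : IsLieAbelian I) : I ≤ LieAlgebra.center ℝ 𝔤 := by
  intro a ha
  rw [LieModule.mem_maxTrivSubmodule]
  intro x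
  by_contra hne
  have h1 : ⁅a, ⁅a, x⁆⁆ = 0 := by
    have h2 : ⁅a, x⁆ ∈ I := lie_mem_left ℝ 𝔤 I a x ha
    exact congrArg Subtype.val (hI.trivial ⟨a, ha⟩ ⟨_, h2⟩)
  have h3 : Φ ⁅a, x⁆ ⁅a, x⁆ = 0 := by rw [hinv, h1]; simp
  have h4 : ⁅a, x⁆ ≠ 0 := by
    rw [← lie_skew, neg_ne_zero]; exact hne
  exact (hp _ h4).ne' h3

theorem iSupIndep_of_orthogonal {W ι : Type*} [AddCommGroup W] [Module ℝ W]
    (Φ : LinearMap.BilinForm ℝ W) (hp : ∀ x, x ≠ 0 → 0 < Φ x x) (N : ι → Submodule ℝ W)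
    (hN : ∀ i j, i ≠ j → ∀ x ∈ N i, ∀ y ∈ N j, Φ x y = 0) : iSupIndep N := by
  intro i
  have h : ⨆ j, ⨆ _ : j ≠ i, N j ≤ Φ.orthogonal (N i) :=
    iSup₂_le fun j hj y hy x hx => hN i j hj.symm x hx y hy
  refine Disjoint.mono_right h ?_
  rw [Submodule.disjoint_def]
  intro x hx hx'
  by_contra hne
  exact (hp x hne).ne' (hx' x hx)

theorem lie_eq_zero_of_disjoint {I J : LieIdeal ℝ 𝔤} (h : Disjoint I J) {x y : 𝔤}
    (hx : x ∈ I) (hy : y ∈ J) : ⁅x, y⁆ = 0 := by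
  rw [← LieSubmodule.mem_bot (R := ℝ) (L := 𝔤), ← h.eq_bot]
  exact ⟨lie_mem_left ℝ 𝔤 I x y hx, lie_mem_right ℝ 𝔤 J x y hy⟩

/-- An ideal of `I` is already an ideal of `𝔤`, since the complement `K` commutes with `I`;
minimality of `I` then applies to it. -/
theorem isSimple_of_isAtom_of_isCompl {I K : LieIdeal ℝ 𝔤} (hI : IsAtom I) (hK : IsCompl I K)
    (hna : ¬ IsLieAbelian I) : LieAlgebra.IsSimple ℝ I where
  non_abelian := hna
  eq_bot_or_eq_top := by
    intro J
    let J' : LieIdeal ℝ 𝔤 :=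
    { __ := J.toSubmodule.map I.toSubmodule.subtype
      lie_mem := by
        rintro x _ ⟨y, hy, rfl⟩
        have hx : x ∈ I ⊔ K := by rw [hK.sup_eq_top]; exact LieSubmodule.mem_top x
        rw [LieSubmodule.mem_sup] at hx
        obtain ⟨a, ha, b, hb, rfl⟩ := hx
        refine ⟨⁅(⟨a, ha⟩ : I), y⁆, lie_mem_right ℝ I J ⟨a, ha⟩ y hy, ?_⟩
        have : ⁅b, (y : 𝔤)⁆ = 0 := lie_eq_zero_of_disjoint hK.disjoint.symm hb y.2
        change ⁅a, (y : 𝔤)⁆ = ⁅a + b, (y : 𝔤)⁆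
        rw [add_lie, this, add_zero] }
    have hmem : ∀ y : 𝔤, y ∈ J' ↔ ∃ z ∈ J, (z : 𝔤) = y := fun y => Iff.rfl
    have hle : J' ≤ I := by
      intro y hy
      obtain ⟨z, -, rfl⟩ := (hmem y).1 hy
      exact z.2
    rcases hI.le_iff.1 hle with h | h
    · left
      rw [eq_bot_iff]
      intro x hx
      have h1 : (x : 𝔤) ∈ J' := (hmem _).2 ⟨x, hx, rfl⟩
      rw [h, LieSubmodule.mem_bot] at h1
      exact (LieSubmodule.mem_bot x).2 (Subtype.ext h1)
    · right
      rw [eq_top_iff]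
      intro x _
      have h1 : (x : 𝔤) ∈ J' := by rw [h]; exact x.2
      obtain ⟨z, hz, hzx⟩ := (hmem _).1 h1
      rwa [← Subtype.ext hzx]

/-- A real Lie algebra with an invariant inner product is the direct sum of simple ideals and its
center. -/
theorem exists_isReductiveDecomposition (Φ : LinearMap.BilinForm ℝ 𝔤)
    (hs : ∀ x y, Φ x y = Φ y x) (hp : ∀ x, x ≠ 0 → 0 < Φ x x) (hinv : Φ.lieInvariant 𝔤) :
    ∃ (n : ℕ) (𝔞 : Fin n → LieIdeal ℝ 𝔤), IsReductiveDecomposition 𝔞 := by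
  have hcompl := isCompl_orthogonal_of_pos Φ hs hp hinv
  -- With modularity and finite dimension this makes the lattice of ideals atomistic, which is what
  -- `sSup_atoms_eq_top` uses below.
  have : ComplementedLattice (LieIdeal ℝ 𝔤) := ⟨fun I => ⟨_, hcompl I⟩⟩
  let S := {I : LieIdeal ℝ 𝔤 // IsAtom I ∧ ¬ IsLieAbelian I}
  -- a non-abelian atom is orthogonal to everything that it centralizes
  have horth : ∀ I : LieIdeal ℝ 𝔤, IsAtom I → ¬ IsLieAbelian I → ∀ y, (∀ x ∈ I, ⁅x, y⁆ = 0) →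
      ∀ x ∈ I, Φ x y = 0 := by
    intro I hI hna y hy x hx
    -- Here `I = [I, I]`, so it is enough to treat `x = [a, b]`, where `Φ([a, b], y) = -Φ(b, [a, y])
    -- = 0`.
    rw [← lie_eq_self_of_isAtom_of_nonabelian I hI hna, ← LieSubmodule.mem_toSubmodule,
      LieSubmodule.lieIdeal_oper_eq_linear_span] at hx
    induction hx using Submodule.span_induction with
    | mem z hz =>
      obtain ⟨a, b, rfl⟩ := hz
      have h1 : Φ ⁅(a : 𝔤), (b : 𝔤)⁆ y = 0 := by rw [hinv, hy a a.2]; simp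
      exact h1
    | zero => simp
    | add u v _ _ hu hv => simp [hu, hv]
    | smul c u _ hu => simp [hu]
  have hSS : ∀ I J : S, I ≠ J → ∀ x ∈ I.1, ∀ y ∈ J.1, Φ x y = 0 := by
    intro I J hIJ x hx y hy
    refine horth I.1 I.2.1 I.2.2 y (fun z hz => ?_) x hx
    exact lie_eq_zero_of_disjoint (I.2.1.disjoint_of_ne J.2.1 fun h => hIJ (Subtype.ext h)) hz hy
  have hSc : ∀ I : S, ∀ x ∈ I.1, ∀ y ∈ LieAlgebra.center ℝ 𝔤, Φ x y = 0 := by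
    intro I x hx y hy
    refine horth I.1 I.2.1 I.2.2 y (fun z _ => ?_) x hx
    exact (LieModule.mem_maxTrivSubmodule (R := ℝ) (L := 𝔤) (M := 𝔤) y).1 hy z
  have hfin : Finite S := by
    have hind : iSupIndep fun I : S => I.1.toSubmodule := iSupIndep_of_orthogonal Φ hp _ hSS
    refine WellFoundedGT.finite_of_iSupIndep hind fun I h => I.2.1.1 ?_
    exact (LieSubmodule.toSubmodule_eq_bot _).1 h
  obtain ⟨n, ⟨e⟩⟩ := Finite.exists_equiv_fin S
  refine ⟨n, fun i => (e.symm i).1, fun i =>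
    isSimple_of_isAtom_of_isCompl (e.symm i).2.1 (hcompl _) (e.symm i).2.2, ?_⟩
  apply DirectSum.isInternal_submodule_of_iSupIndep_of_iSup_eq_top
  · refine iSupIndep_of_orthogonal Φ hp _ ?_
    rintro (_ | i) (_ | j) hij x hx y hy
    · exact absurd rfl hij
    · rw [hs]; exact hSc _ y hy x hx
    · exact hSc _ x hx y hy
    · exact hSS _ _ (fun h => hij (by rw [e.symm.injective h])) x hx y hy
  · rw [eq_top_iff, ← LieSubmodule.top_toSubmodule (R := ℝ) (L := 𝔤) (M := 𝔤),
      ← sSup_atoms_eq_top (α := LieIdeal ℝ 𝔤), LieSubmodule.sSup_toSubmodule]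
    refine sSup_le ?_
    rintro _ ⟨I, hI, rfl⟩
    by_cases hna : IsLieAbelian I
    · exact le_iSup_of_le none (le_center_of_isLieAbelian Φ hp hinv I hna)
    · refine le_iSup_of_le (some (e ⟨I, hI, hna⟩)) ?_
      simp

/-- A simple algebra is perfect: its derived ideal is nonzero because the algebra is not abelian.
All vanishing results on simple ideals below rest on this. -/
theorem span_lie_eq_top_of_isSimple (L : Type*) [LieRing L] [LieAlgebra ℝ L]
    [h : LieAlgebra.IsSimple ℝ L] :
    Submodule.span ℝ {z : L | ∃ x y : L, ⁅x, y⁆ = z} = ⊤ := by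
  have h1 : ⁅(⊤ : LieIdeal ℝ L), (⊤ : LieIdeal ℝ L)⁆ = ⊤ := by
    rcases h.eq_bot_or_eq_top ⁅(⊤ : LieIdeal ℝ L), (⊤ : LieIdeal ℝ L)⁆ with h2 | h2
    · refine absurd ⟨fun x y => ?_⟩ h.non_abelian
      rw [← LieSubmodule.mem_bot (R := ℝ) (L := L), ← h2]
      exact LieSubmodule.lie_mem_lie (LieSubmodule.mem_top x) (LieSubmodule.mem_top y)
    · exact h2
  have h2 := congrArg LieSubmodule.toSubmodule h1
  rw [LieSubmodule.lieIdeal_oper_eq_linear_span, LieSubmodule.top_toSubmodule] at h2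
  rw [eq_top_iff, ← h2]
  apply Submodule.span_mono
  rintro _ ⟨x, y, rfl⟩
  exact ⟨x, y, rfl⟩

/-- A symmetric form has an eigenvector relative to a positive definite one. -/
theorem exists_eigenvector_of_symm {W : Type*} [AddCommGroup W] [Module ℝ W]
    [FiniteDimensional ℝ W] [Nontrivial W] (F B : LinearMap.BilinForm ℝ W)
    (hFs : ∀ x y, F x y = F y x) (hFp : ∀ x, x ≠ 0 → 0 < F x x) (hBs : ∀ x y, B x y = B y x) :
    ∃ c : ℝ, ∃ w, w ≠ 0 ∧ ∀ y, B w y = c * F w y := by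
  -- With `F` as the inner product, the operator `T` defined by `F (T x) y = B x y` is self-adjoint,
  -- so it has a real eigenvalue.
  let core : InnerProductSpace.Core ℝ W :=
    { inner := fun x y => F x y
      conj_inner_symm := fun x y => by simp [hFs x y]
      re_inner_nonneg := fun x => by
        by_cases h : x = 0
        · simp [h]
        · exact (hFp x h).le
      add_left := fun x y z => by simp
      smul_left := fun x y r => by simp
      definite := fun x h => by
        by_contra hne
        exact (hFp x hne).ne' h }
  let _ : NormedAddCommGroup W := core.toNormedAddCommGroup
  let _ : InnerProductSpace ℝ W := InnerProductSpace.ofCore core.toCore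
  have hnd : F.Nondegenerate := by
    refine ⟨fun x h => ?_, fun x h => ?_⟩ <;>
    · by_contra hne
      exact (hFp x hne).ne' (h x)
  let T : W →ₗ[ℝ] W := LinearMap.BilinForm.symmCompOfNondegenerate B F hnd
  have hT : ∀ x y, F (T x) y = B x y := fun x y =>
    LinearMap.BilinForm.symmCompOfNondegenerate_left_apply B hnd y x
  have hsym : T.IsSymmetric := by
    intro x y
    change F (T x) y = F x (T y)
    rw [hT, hFs, hT, hBs]
  obtain ⟨c, hc⟩ : ∃ c, Module.End.HasEigenvalue T c :=
    ⟨_, hsym.hasEigenvalue_iSup_of_finiteDimensional⟩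
  obtain ⟨w, hw⟩ := hc.exists_hasEigenvector
  refine ⟨c, w, hw.2, fun y => ?_⟩
  rw [← hT, hw.apply_eq_smul]
  simp

/-- Schur's lemma for symmetric forms: on a simple real Lie algebra, every invariant symmetric form
is a multiple of an invariant inner product. -/
theorem exists_eq_smul_of_isSimple [hL : LieAlgebra.IsSimple ℝ 𝔤] (F B : LinearMap.BilinForm ℝ 𝔤)
    (hFs : ∀ x y, F x y = F y x) (hFp : ∀ x, x ≠ 0 → 0 < F x x) (hFi : F.lieInvariant 𝔤)
    (hBs : ∀ x y, B x y = B y x) (hBi : B.lieInvariant 𝔤) :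
    ∃ c : ℝ, ∀ x y, B x y = c * F x y := by
  have : Nontrivial 𝔤 := LieAlgebra.IsSimple.nontrivial ℝ 𝔤
  obtain ⟨c, w, hw, h⟩ := exists_eigenvector_of_symm F B hFs hFp hBs
  refine ⟨c, ?_⟩
  -- The eigenspace for `c`. Invariance of both forms makes it an ideal; it contains `w`, so it is
  -- everything. Symmetry supplies the real eigenvalue that Schur's lemma over `ℝ` lacks in general.
  let I : LieIdeal ℝ 𝔤 :=
    { carrier := {x | ∀ y, B x y = c * F x y}
      add_mem' := fun {a b} ha hb y => by simp [ha y, hb y, mul_add]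
      zero_mem' := fun y => by simp
      smul_mem' := fun r x hx y => by simp [hx y]; ring
      lie_mem := fun {z x} hx y => by rw [hBi, hFi, hx]; ring }
  rcases hL.eq_bot_or_eq_top I with h1 | h1
  · have : w ∈ I := h
    rw [h1, LieSubmodule.mem_bot] at this
    exact absurd this hw
  · intro x
    have : x ∈ I := by rw [h1]; exact LieSubmodule.mem_top x
    exact this

end LieAlgebraForms

/-! ### The adjoint action and the multiplication in the chart at the identity -/

section AdjointRepresentation

variable {E : Type*} [NormedAddCommGroup E] [NormedSpace ℝ E]
  {G : Type*} [TopologicalSpace G] [ChartedSpace E G] [Group G] [LieGroup 𝓘(ℝ, E) ∞ G]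

theorem contMDiff_conj_uncurry :
    ContMDiff (𝓘(ℝ, E).prod 𝓘(ℝ, E)) 𝓘(ℝ, E) ∞ (fun q : G × G => q.1 * q.2 * q.1⁻¹) :=
  (contMDiff_fst.mul contMDiff_snd).mul contMDiff_fst.inv

theorem mdifferentiable_conj (g : G) :
    MDifferentiable 𝓘(ℝ, E) 𝓘(ℝ, E) (fun h : G => g * h * g⁻¹) := by
  have h : ContMDiff 𝓘(ℝ, E) 𝓘(ℝ, E) ∞ (fun h : G => g * h * g⁻¹) :=
    (contMDiff_const.mul contMDiff_id).mul contMDiff_const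
  exact h.mdifferentiable (by simp)

/-- The adjoint action of `g` on the tangent space at `1`. -/
noncomputable def adAction (E : Type*) [NormedAddCommGroup E] [NormedSpace ℝ E]
    {G : Type*} [TopologicalSpace G] [ChartedSpace E G] [Group G] (g : G) : E →L[ℝ] E :=
  mfderiv 𝓘(ℝ, E) 𝓘(ℝ, E) (fun h : G => g * h * g⁻¹) 1

theorem hasMFDerivAt_conj (g : G) :
    HasMFDerivAt 𝓘(ℝ, E) 𝓘(ℝ, E) (fun h : G => g * h * g⁻¹) 1 (adAction E g) :=
  (mdifferentiable_conj g 1).hasMFDerivAt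

theorem adAction_one : adAction E (1 : G) = ContinuousLinearMap.id ℝ E := by
  have h : HasMFDerivAt 𝓘(ℝ, E) 𝓘(ℝ, E) (fun h : G => (1 : G) * h * (1 : G)⁻¹) 1
      (ContinuousLinearMap.id ℝ E) := by
    have h1 : (fun h : G => (1 : G) * h * (1 : G)⁻¹) = id := by funext h; simp
    rw [h1]
    exact hasMFDerivAt_id 1
  exact hasMFDerivAt_unique (hasMFDerivAt_conj (1 : G)) h

theorem adAction_mul (g k : G) : adAction E (g * k) = (adAction E g).comp (adAction E k) := by
  have h1 : HasMFDerivAt 𝓘(ℝ, E) 𝓘(ℝ, E) (fun h : G => g * h * g⁻¹) (k * 1 * k⁻¹)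
      (adAction E g) := by
    have h2 : k * 1 * k⁻¹ = 1 := by simp
    rw [h2]
    exact hasMFDerivAt_conj g
  have h3 := HasMFDerivAt.comp (x := (1 : G)) (f := fun h : G => k * h * k⁻¹) h1
    (hasMFDerivAt_conj k)
  have h4 : ((fun h : G => g * h * g⁻¹) ∘ fun h : G => k * h * k⁻¹) =
      fun h : G => g * k * h * (g * k)⁻¹ := by
    funext h; simp [mul_assoc]
  rw [h4] at h3
  exact hasMFDerivAt_unique (hasMFDerivAt_conj (g * k)) h3

theorem contMDiff_adAction :
    ContMDiff 𝓘(ℝ, E) 𝓘(ℝ, E →L[ℝ] E) ∞ (fun g : G => adAction E g) := by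
  have : IsManifold 𝓘(ℝ, E) 1 G := IsManifold.of_le (n := ∞) ENat.LEInfty.out
  intro g
  have h := ContMDiffAt.mfderiv (I := 𝓘(ℝ, E)) (I' := 𝓘(ℝ, E)) (J := 𝓘(ℝ, E)) (n := ∞) (m := ∞)
    (x₀ := g)
    (fun g h : G => g * h * g⁻¹) (fun _ => 1) contMDiff_conj_uncurry.contMDiffAt
    contMDiffAt_const (by simp)
  refine h.congr_of_eventuallyEq (Filter.Eventually.of_forall fun k => ?_)
  -- `ContMDiffAt.mfderiv` gives smoothness in tangent coordinates. Conjugation fixes `1`, so both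
  -- coordinate changes go from the chart at `1` to itself and are trivial.
  have e1 : ∀ k : G, k * 1 * k⁻¹ = 1 := fun k => by simp
  have hk := inTangentCoordinates_eq (I := 𝓘(ℝ, E)) (I' := 𝓘(ℝ, E)) (fun _ : G => (1 : G))
    (fun x : G => x * 1 * x⁻¹) (fun x => adAction E x) (x₀ := g) (x := k)
    (mem_chart_source E (1 : G)) (by simp only [e1]; exact mem_chart_source E (1 : G))
  refine Eq.trans ?_ hk.symm
  ext v
  simp only [e1, ContinuousLinearMap.comp_apply]
  rw [(tangentBundleCore 𝓘(ℝ, E) G).coordChange_self _ _ (mem_chart_source E (1 : G)),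
    (tangentBundleCore 𝓘(ℝ, E) G).coordChange_self _ _ (mem_chart_source E (1 : G))]

/-- The group multiplication in the chart at `1`. -/
noncomputable def chartMul (E : Type*) [NormedAddCommGroup E] [NormedSpace ℝ E]
    (G : Type*) [TopologicalSpace G] [ChartedSpace E G] [Group G] (q : E × E) : E :=
  extChartAt 𝓘(ℝ, E) (1 : G)
    ((extChartAt 𝓘(ℝ, E) (1 : G)).symm q.1 * (extChartAt 𝓘(ℝ, E) (1 : G)).symm q.2)

theorem contDiffAt_chartMul :
    ContDiffAt ℝ ∞ (chartMul E G)
      (extChartAt 𝓘(ℝ, E) (1 : G) 1, extChartAt 𝓘(ℝ, E) (1 : G) 1) := by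
  set e := extChartAt 𝓘(ℝ, E) (1 : G) with he
  have hs : ContMDiffAt 𝓘(ℝ, E) 𝓘(ℝ, E) ∞ e.symm (e 1) :=
    (contMDiffOn_extChartAt_symm (1 : G)).contMDiffAt (extChartAt_target_mem_nhds (1 : G))
  have h1 : ContMDiffAt 𝓘(ℝ, E × E) 𝓘(ℝ, E) ∞ (fun q : E × E => e.symm q.1 * e.symm q.2)
      (e 1, e 1) := by
    refine ContMDiffAt.mul ?_ ?_
    · exact ContMDiffAt.comp (e 1, e 1) (g := e.symm) (f := Prod.fst) hs
        contDiff_fst.contMDiff.contMDiffAt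
    · exact ContMDiffAt.comp (e 1, e 1) (g := e.symm) (f := Prod.snd) hs
        contDiff_snd.contMDiff.contMDiffAt
  have h2 : e.symm (e 1) * e.symm (e 1) = 1 := by
    rw [extChartAt_to_inv (I := 𝓘(ℝ, E)) (1 : G), one_mul]
  have h3 : ContMDiffAt 𝓘(ℝ, E) 𝓘(ℝ, E) ∞ e (e.symm (e 1) * e.symm (e 1)) := by
    rw [h2]; exact contMDiffAt_extChartAt
  exact (ContMDiffAt.comp (e 1, e 1) (g := e) h3 h1).contDiffAt

theorem chartMul_left {a : E} (ha : a ∈ (extChartAt 𝓘(ℝ, E) (1 : G)).target) :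
    chartMul E G (a, extChartAt 𝓘(ℝ, E) (1 : G) 1) = a := by
  simp only [chartMul]
  rw [extChartAt_to_inv (I := 𝓘(ℝ, E)) (1 : G), mul_one, PartialEquiv.right_inv _ ha]

theorem chartMul_right {a : E} (ha : a ∈ (extChartAt 𝓘(ℝ, E) (1 : G)).target) :
    chartMul E G (extChartAt 𝓘(ℝ, E) (1 : G) 1, a) = a := by
  simp only [chartMul]
  rw [extChartAt_to_inv (I := 𝓘(ℝ, E)) (1 : G), one_mul, PartialEquiv.right_inv _ ha]

theorem fderiv_chartMul_left (v : E) :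
    fderiv ℝ (chartMul E G) (extChartAt 𝓘(ℝ, E) (1 : G) 1, extChartAt 𝓘(ℝ, E) (1 : G) 1) (v, 0)
      = v := by
  set p := extChartAt 𝓘(ℝ, E) (1 : G) 1 with hp
  have h1 : HasFDerivAt (chartMul E G) (fderiv ℝ (chartMul E G) (p, p)) (p, p) :=
    (contDiffAt_chartMul.differentiableAt (by simp)).hasFDerivAt
  have h2 : HasFDerivAt (fun a : E => (a, p)) (ContinuousLinearMap.inl ℝ E E) p :=
    hasFDerivAt_prodMk_left p p
  have h3 := HasFDerivAt.comp (f := fun a : E => (a, p)) p h1 h2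
  have h4 : HasFDerivAt (chartMul E G ∘ fun a : E => (a, p)) (ContinuousLinearMap.id ℝ E) p := by
    refine (hasFDerivAt_id p).congr_of_eventuallyEq ?_
    filter_upwards [extChartAt_target_mem_nhds (I := 𝓘(ℝ, E)) (1 : G)] with a ha
    exact chartMul_left ha
  exact congrArg (fun T : E →L[ℝ] E => T v) (h3.unique h4)

theorem fderiv_chartMul_right (v : E) :
    fderiv ℝ (chartMul E G) (extChartAt 𝓘(ℝ, E) (1 : G) 1, extChartAt 𝓘(ℝ, E) (1 : G) 1) (0, v)
      = v := by
  set p := extChartAt 𝓘(ℝ, E) (1 : G) 1 with hp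
  have h1 : HasFDerivAt (chartMul E G) (fderiv ℝ (chartMul E G) (p, p)) (p, p) :=
    (contDiffAt_chartMul.differentiableAt (by simp)).hasFDerivAt
  have h2 : HasFDerivAt (fun a : E => (p, a)) (ContinuousLinearMap.inr ℝ E E) p :=
    hasFDerivAt_prodMk_right p p
  have h3 := HasFDerivAt.comp (f := fun a : E => (p, a)) p h1 h2
  have h4 : HasFDerivAt (chartMul E G ∘ fun a : E => (p, a)) (ContinuousLinearMap.id ℝ E) p := by
    refine (hasFDerivAt_id p).congr_of_eventuallyEq ?_
    filter_upwards [extChartAt_target_mem_nhds (I := 𝓘(ℝ, E)) (1 : G)] with a ha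
    exact chartMul_right ha
  exact congrArg (fun T : E →L[ℝ] E => T v) (h3.unique h4)

theorem eventually_differentiableAt_chartMul :
    ∀ᶠ q in nhds (extChartAt 𝓘(ℝ, E) (1 : G) 1, extChartAt 𝓘(ℝ, E) (1 : G) 1),
      DifferentiableAt ℝ (chartMul E G) q := by
  have h : ContDiffAt ℝ 1 (chartMul E G)
      (extChartAt 𝓘(ℝ, E) (1 : G) 1, extChartAt 𝓘(ℝ, E) (1 : G) 1) :=
    contDiffAt_chartMul.of_le ENat.LEInfty.out
  filter_upwards [h.eventually (by simp)] with q hq using hq.differentiableAt (by simp)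

/-- Writing `g h = (g h g⁻¹) g` and differentiating in `h` at `1`. -/
theorem eventually_fderiv_chartMul_adAction (y : E) :
    ∀ᶠ a in nhds (extChartAt 𝓘(ℝ, E) (1 : G) 1),
      fderiv ℝ (chartMul E G) (a, extChartAt 𝓘(ℝ, E) (1 : G) 1) (0, y) =
        fderiv ℝ (chartMul E G) (extChartAt 𝓘(ℝ, E) (1 : G) 1, a)
          (adAction E ((extChartAt 𝓘(ℝ, E) (1 : G)).symm a) y, 0) := by
  set e := extChartAt 𝓘(ℝ, E) (1 : G) with he
  set p := e 1 with hp
  have c1 : Filter.Tendsto (fun a : E => (a, p)) (nhds p) (nhds (p, p)) :=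
    (Continuous.prodMk_left p).tendsto p
  have c2 : Filter.Tendsto (fun a : E => (p, a)) (nhds p) (nhds (p, p)) :=
    (Continuous.prodMk_right p).tendsto p
  filter_upwards [c1.eventually eventually_differentiableAt_chartMul,
    c2.eventually eventually_differentiableAt_chartMul] with a ha1 ha2
  set g := e.symm a with hg
  have hsymm : e.symm p = 1 := extChartAt_to_inv (I := 𝓘(ℝ, E)) (1 : G)
  -- conjugation by `g` in the chart
  have hw : HasFDerivAt (fun b : E => e (g * e.symm b * g⁻¹)) (adAction E g) p := by
    have h1 : HasMFDerivAt 𝓘(ℝ, E) 𝓘(ℝ, E) e.symm p (ContinuousLinearMap.id ℝ E) := by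
      have h := (mdifferentiableWithinAt_extChartAt_symm
        (mem_extChartAt_target (I := 𝓘(ℝ, E)) (1 : G))).hasMFDerivWithinAt
      have h2 : (mfderivWithin 𝓘(ℝ, E) 𝓘(ℝ, E) e.symm (Set.range 𝓘(ℝ, E)) p : E →L[ℝ] E)
        = (ContinuousLinearMap.id ℝ E : E →L[ℝ] E) := mfderivWithin_range_extChartAt_symm
      have h3 : (Set.range 𝓘(ℝ, E)) = Set.univ := by simp
      rw [← he, ← hp] at h
      rw [h3] at h h2
      have h4 := hasMFDerivWithinAt_univ.1 h
      exact h2 ▸ h4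
    have h2 : HasMFDerivAt 𝓘(ℝ, E) 𝓘(ℝ, E) (fun h : G => g * h * g⁻¹) (e.symm p)
        (adAction E g) := by
      rw [hsymm]; exact hasMFDerivAt_conj g
    have h3 : HasMFDerivAt 𝓘(ℝ, E) 𝓘(ℝ, E) e (g * e.symm p * g⁻¹)
        (ContinuousLinearMap.id ℝ E) := by
      have h4 : g * e.symm p * g⁻¹ = 1 := by rw [hsymm]; simp
      rw [h4]
      have h5 := (mdifferentiableAt_extChartAt (I := 𝓘(ℝ, E))
        (mem_chart_source E (1 : G))).hasMFDerivAt
      have h6 : (mfderiv 𝓘(ℝ, E) 𝓘(ℝ, E) e (1 : G) : E →L[ℝ] E) = ContinuousLinearMap.id ℝ E :=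
        mfderiv_extChartAt_self
      exact h6 ▸ h5
    have h7 := HasMFDerivAt.comp (x := p) (f := fun b => g * e.symm b * g⁻¹) (g := e) h3
      (HasMFDerivAt.comp (x := p) (f := e.symm) (g := fun h : G => g * h * g⁻¹) h2 h1)
    exact hasMFDerivAt_iff_hasFDerivAt.1 h7
  have hwp : e (g * e.symm p * g⁻¹) = p := by rw [hsymm]; simp [hp]
  have hL : HasFDerivAt (fun b : E => chartMul E G (a, b))
      ((fderiv ℝ (chartMul E G) (a, p)).comp (ContinuousLinearMap.inr ℝ E E)) p :=
    HasFDerivAt.comp (f := fun b : E => (a, b)) p ha1.hasFDerivAt (hasFDerivAt_prodMk_right a p)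
  have hR : HasFDerivAt (fun b : E => chartMul E G (e (g * e.symm b * g⁻¹), a))
      ((fderiv ℝ (chartMul E G) (p, a)).comp ((adAction E g).prod (0 : E →L[ℝ] E))) p := by
    have h1 : HasFDerivAt (chartMul E G) (fderiv ℝ (chartMul E G) (p, a))
        (e (g * e.symm p * g⁻¹), a) := by
      rw [hwp]
      exact ha2.hasFDerivAt
    exact HasFDerivAt.comp (f := fun b : E => (e (g * e.symm b * g⁻¹), a)) p h1
      (hw.prodMk (hasFDerivAt_const a p))
  have hcont : ContinuousAt (fun b : E => g * e.symm b * g⁻¹) p := by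
    have h1 : ContinuousAt e.symm p := continuousAt_extChartAt_symm (1 : G)
    have : IsTopologicalGroup G := topologicalGroup_of_lieGroup 𝓘(ℝ, E) ∞
    exact (continuousAt_const.mul h1).mul continuousAt_const
  -- Valid only for `b` near `p`: the conjugate must stay in the chart domain for `e.symm` to undo
  -- `e`.
  have hev : (fun b : E => chartMul E G (a, b)) =ᶠ[nhds p]
      fun b : E => chartMul E G (e (g * e.symm b * g⁻¹), a) := by
    have h1 : e.source ∈ nhds (g * e.symm p * g⁻¹) := by
      have h4 : g * e.symm p * g⁻¹ = 1 := by rw [hsymm]; simp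
      rw [h4]
      exact extChartAt_source_mem_nhds (1 : G)
    filter_upwards [hcont.preimage_mem_nhds h1] with b hb
    simp only [chartMul]
    rw [← he, PartialEquiv.left_inv _ hb, ← hg]
    simp
  have := congrArg (fun T : E →L[ℝ] E => T y) (hL.unique (hR.congr_of_eventuallyEq hev))
  simpa using this

end AdjointRepresentation

/-! ### The derivative of `Ad` is the bracket of left-invariant fields -/

section AdjointDerivative

variable {E : Type*} [NormedAddCommGroup E] [NormedSpace ℝ E]
  {G : Type*} [TopologicalSpace G] [ChartedSpace E G] [Group G] [LieGroup 𝓘(ℝ, E) ∞ G]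

/-- The left-invariant vector fields in the chart at `1`. -/
theorem eventually_mpullbackWithin_mulInvariantVectorField [CompleteSpace E]
    (v : GroupLieAlgebra 𝓘(ℝ, E) G) :
    ∀ᶠ a in nhds (extChartAt 𝓘(ℝ, E) (1 : G) 1),
      (mpullbackWithin 𝓘(ℝ, E) 𝓘(ℝ, E) (extChartAt 𝓘(ℝ, E) (1 : G)).symm
        (mulInvariantVectorField v) (Set.range 𝓘(ℝ, E)) a : E) =
      fderiv ℝ (chartMul E G) (a, extChartAt 𝓘(ℝ, E) (1 : G) 1) (0, v) := by
  have : IsManifold 𝓘(ℝ, E) 1 G := IsManifold.of_le (n := ∞) ENat.LEInfty.out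
  set e := extChartAt 𝓘(ℝ, E) (1 : G) with he
  set p := e 1 with hp
  have c1 : Filter.Tendsto (fun a : E => (a, p)) (nhds p) (nhds (p, p)) :=
    (Continuous.prodMk_left p).tendsto p
  filter_upwards [c1.eventually eventually_differentiableAt_chartMul,
    extChartAt_target_mem_nhds (I := 𝓘(ℝ, E)) (1 : G)] with a ha1 ha
  set g := e.symm a with hg
  have hsymm : e.symm p = 1 := extChartAt_to_inv (I := 𝓘(ℝ, E)) (1 : G)
  have hrange : (Set.range 𝓘(ℝ, E)) = Set.univ := by simp
  have hinv := isInvertible_mfderivWithin_extChartAt_symm (I := 𝓘(ℝ, E)) (x := (1 : G)) ha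
  set S : E →L[ℝ] E := mfderivWithin 𝓘(ℝ, E) 𝓘(ℝ, E) e.symm (Set.range 𝓘(ℝ, E)) a with hS
  have hSd : HasMFDerivAt 𝓘(ℝ, E) 𝓘(ℝ, E) e.symm a S := by
    have h := (mdifferentiableWithinAt_extChartAt_symm (I := 𝓘(ℝ, E)) ha).hasMFDerivWithinAt
    rw [hrange] at h hS
    exact hS ▸ hasMFDerivWithinAt_univ.1 h
  have hpd : HasMFDerivAt 𝓘(ℝ, E) 𝓘(ℝ, E) e.symm p (ContinuousLinearMap.id ℝ E) := by
    have h := (mdifferentiableWithinAt_extChartAt_symm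
      (mem_extChartAt_target (I := 𝓘(ℝ, E)) (1 : G))).hasMFDerivWithinAt
    have h2 : (mfderivWithin 𝓘(ℝ, E) 𝓘(ℝ, E) e.symm (Set.range 𝓘(ℝ, E)) p : E →L[ℝ] E)
      = (ContinuousLinearMap.id ℝ E : E →L[ℝ] E) := mfderivWithin_range_extChartAt_symm
    rw [← he, ← hp] at h
    rw [hrange] at h h2
    have h4 := hasMFDerivWithinAt_univ.1 h
    exact h2 ▸ h4
  have hmul : HasMFDerivAt 𝓘(ℝ, E) 𝓘(ℝ, E) (fun h : G => g * h) (e.symm p)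
      (mfderiv 𝓘(ℝ, E) 𝓘(ℝ, E) (fun h : G => g * h) 1 : E →L[ℝ] E) := by
    rw [hsymm]
    exact ((contMDiff_mul_left (I := 𝓘(ℝ, E)) (n := ∞) (a := g)).mdifferentiable
        (by simp) 1).hasMFDerivAt
  have hL := HasMFDerivAt.comp (x := p) (f := e.symm) (g := fun h : G => g * h) hmul hpd
  have hmu : HasMFDerivAt 𝓘(ℝ, E) 𝓘(ℝ, E) (fun b : E => chartMul E G (a, b)) p
      ((fderiv ℝ (chartMul E G) (a, p)).comp (ContinuousLinearMap.inr ℝ E E)) :=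
    (HasFDerivAt.comp (f := fun b : E => (a, b)) p ha1.hasFDerivAt
      (hasFDerivAt_prodMk_right a p)).hasMFDerivAt
  have hSd' : HasMFDerivAt 𝓘(ℝ, E) 𝓘(ℝ, E) e.symm (chartMul E G (a, p)) S := by
    rw [chartMul_left ha]; exact hSd
  have hR := HasMFDerivAt.comp (x := p) (f := fun b : E => chartMul E G (a, b)) (g := e.symm)
    hSd' hmu
  have hcont : ContinuousAt (fun b : E => g * e.symm b) p := by
    have h1 : ContinuousAt e.symm p := continuousAt_extChartAt_symm (1 : G)
    have : IsTopologicalGroup G := topologicalGroup_of_lieGroup 𝓘(ℝ, E) ∞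
    exact continuousAt_const.mul h1
  -- Left translation by `g`, factored through the chart. Differentiating at `p` expresses the
  -- invariant field at `g` as `S` applied to a derivative of `chartMul`; the pullback then inverts
  -- `S`.
  have hev : ((fun h : G => g * h) ∘ e.symm) =ᶠ[nhds p]
      (e.symm ∘ fun b : E => chartMul E G (a, b)) := by
    have h1 : e.source ∈ nhds (g * e.symm p) := by
      rw [hsymm, mul_one]
      exact (isOpen_extChartAt_source (1 : G)).mem_nhds (e.map_target ha)
    filter_upwards [hcont.preimage_mem_nhds h1] with b hb
    simp only [chartMul, Function.comp]
    rw [← he, PartialEquiv.left_inv _ hb]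
  have h1 := congrArg (fun T : E →L[ℝ] E => T v)
    (hasMFDerivAt_unique hL (hR.congr_of_eventuallyEq hev))
  have h2 : (mulInvariantVectorField v g : E) =
      S (fderiv ℝ (chartMul E G) (a, p) (0, v)) := h1
  have h3 : (mpullbackWithin 𝓘(ℝ, E) 𝓘(ℝ, E) e.symm
        (mulInvariantVectorField v) (Set.range 𝓘(ℝ, E)) a : E) =
      S.inverse (mulInvariantVectorField v g : E) := rfl
  rw [h3, h2]
  exact ContinuousLinearMap.IsInvertible.inverse_apply_self hinv _

variable [FiniteDimensional ℝ E]

/-- The bracket is computed in the chart at `1` and carried back by the inverse of the chart's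
derivative there, which is the identity. -/
theorem groupLieAlgebra_bracket_eq (x y : GroupLieAlgebra 𝓘(ℝ, E) G) :
    @Eq E (⁅x, y⁆ : GroupLieAlgebra 𝓘(ℝ, E) G) (lieBracket ℝ
      (mpullbackWithin 𝓘(ℝ, E) 𝓘(ℝ, E) (extChartAt 𝓘(ℝ, E) (1 : G)).symm
        (mulInvariantVectorField x) (Set.range 𝓘(ℝ, E)))
      (mpullbackWithin 𝓘(ℝ, E) 𝓘(ℝ, E) (extChartAt 𝓘(ℝ, E) (1 : G)).symm
        (mulInvariantVectorField y) (Set.range 𝓘(ℝ, E))) (extChartAt 𝓘(ℝ, E) (1 : G) 1)) := by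
  set e := extChartAt 𝓘(ℝ, E) (1 : G) with he
  have hs : e.symm ⁻¹' Set.univ ∩ Set.range 𝓘(ℝ, E) = Set.univ := by simp
  set Fv : GroupLieAlgebra 𝓘(ℝ, E) G → E → E := fun v =>
    mpullbackWithin 𝓘(ℝ, E) 𝓘(ℝ, E) e.symm (mulInvariantVectorField v) (Set.range 𝓘(ℝ, E))
    with hFv
  set w : E := lieBracketWithin ℝ (Fv x) (Fv y)
      (e.symm ⁻¹' Set.univ ∩ Set.range 𝓘(ℝ, E)) (e 1) with hw
  have h1 : w = lieBracket ℝ (Fv x) (Fv y) (e 1) := by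
    rw [hw, hs, lieBracketWithin_univ]
  have h2 : (mfderiv 𝓘(ℝ, E) 𝓘(ℝ, E) e (1 : G) : E →L[ℝ] E).inverse =
      ContinuousLinearMap.id ℝ E := by
    have h3 : (mfderiv 𝓘(ℝ, E) 𝓘(ℝ, E) e (1 : G) : E →L[ℝ] E) = ContinuousLinearMap.id ℝ E :=
      mfderiv_extChartAt_self
    rw [h3]
    exact ContinuousLinearMap.inverse_id
  have h4 : (⁅x, y⁆ : GroupLieAlgebra 𝓘(ℝ, E) G) =
      (mfderiv 𝓘(ℝ, E) 𝓘(ℝ, E) e (1 : G) : E →L[ℝ] E).inverse w := rfl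
  rw [h4, h1, h2]
  rfl

/-- The derivative of the adjoint representation is the Lie bracket. -/
theorem exists_hasFDerivAt_adAction :
    ∃ A' : E →L[ℝ] E →L[ℝ] E,
      HasFDerivAt (fun a : E => adAction E ((extChartAt 𝓘(ℝ, E) (1 : G)).symm a)) A'
        (extChartAt 𝓘(ℝ, E) (1 : G) 1) ∧
      ∀ x y : GroupLieAlgebra 𝓘(ℝ, E) G, @Eq E (A' x y) (⁅x, y⁆ : GroupLieAlgebra 𝓘(ℝ, E) G) := by
  set e := extChartAt 𝓘(ℝ, E) (1 : G) with he
  set p := e 1 with hp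
  have hsymm : e.symm p = 1 := extChartAt_to_inv (I := 𝓘(ℝ, E)) (1 : G)
  have hd : DifferentiableAt ℝ (fun a : E => adAction E (e.symm a)) p := by
    have h1 : ContMDiffAt 𝓘(ℝ, E) 𝓘(ℝ, E) ∞ e.symm p :=
      (contMDiffOn_extChartAt_symm (1 : G)).contMDiffAt (extChartAt_target_mem_nhds (1 : G))
    have h2 : ContMDiffAt 𝓘(ℝ, E) 𝓘(ℝ, E →L[ℝ] E) ∞ (fun a : E => adAction E (e.symm a)) p :=
      contMDiff_adAction.contMDiffAt.comp p h1
    exact h2.contDiffAt.differentiableAt (by simp)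
  refine ⟨_, hd.hasFDerivAt, fun x y => ?_⟩
  set A' := fderiv ℝ (fun a : E => adAction E (e.symm a)) p with hA'
  set D := fderiv ℝ (chartMul E G) with hD
  have hDd : DifferentiableAt ℝ D (p, p) := by
    have h : ContDiffAt ℝ 2 (chartMul E G) (p, p) := contDiffAt_chartMul.of_le ENat.LEInfty.out
    exact (h.fderiv_right (m := 1) (by norm_num)).differentiableAt (by simp)
  set S := fderiv ℝ D (p, p) with hS
  have hSsymm : ∀ u v, S u v = S v u := by
    have h : ContDiffAt ℝ 2 (chartMul E G) (p, p) := contDiffAt_chartMul.of_le ENat.LEInfty.out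
    exact fun u v => (h.isSymmSndFDerivAt (by simp)).eq u v
  have hl : HasFDerivAt (fun a : E => D (a, p)) (S.comp (ContinuousLinearMap.inl ℝ E E)) p :=
    HasFDerivAt.comp (f := fun a : E => (a, p)) p hDd.hasFDerivAt (hasFDerivAt_prodMk_left p p)
  have hr : HasFDerivAt (fun a : E => D (p, a)) (S.comp (ContinuousLinearMap.inr ℝ E E)) p :=
    HasFDerivAt.comp (f := fun a : E => (p, a)) p hDd.hasFDerivAt (hasFDerivAt_prodMk_right p p)
  have hlv : ∀ v : E, HasFDerivAt (fun a : E => D (a, p) (0, v))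
      ((S.comp (ContinuousLinearMap.inl ℝ E E)).flip (0, v)) p := fun v => by
    have := hl.clm_apply (hasFDerivAt_const ((0 : E), v) p)
    simpa using this
  have hbr : ∀ u v : GroupLieAlgebra 𝓘(ℝ, E) G, fderiv ℝ (mpullbackWithin 𝓘(ℝ, E) 𝓘(ℝ, E) e.symm
      (mulInvariantVectorField v) (Set.range 𝓘(ℝ, E)) : E → E) p u = S (u, 0) (0, v) := by
    intro u v
    have h := ((hlv v).congr_of_eventuallyEq
      (eventually_mpullbackWithin_mulInvariantVectorField v)).fderiv
    exact congrArg (fun T : E →L[ℝ] E => T u) h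
  have hval : ∀ v : GroupLieAlgebra 𝓘(ℝ, E) G, (mpullbackWithin 𝓘(ℝ, E) 𝓘(ℝ, E) e.symm
      (mulInvariantVectorField v) (Set.range 𝓘(ℝ, E)) p : E) = v := fun v =>
    (eventually_mpullbackWithin_mulInvariantVectorField v).self_of_nhds.trans
      (fderiv_chartMul_right (E := E) (G := G) v)
  -- Differentiate `D (a, p) (0, y) = D (p, a) (Ad_a y, 0)` at `a = p` in direction `x`: `S (x, 0)
  -- (0, y) = A' x y + S (0, x) (y, 0)`. By symmetry of `S` the last term is `S (y, 0) (0, x)`. By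
  -- `hbr` the difference is the bracket of the invariant fields.
  have hkey : ∀ x y : E, A' x y = S (x, 0) (0, y) - S (y, 0) (0, x) := by
    intro x y
    have h1 : HasFDerivAt (fun a : E => adAction E (e.symm a) y) (A'.flip y) p := by
      have := hd.hasFDerivAt.clm_apply (hasFDerivAt_const y p)
      rw [ContinuousLinearMap.comp_zero, zero_add] at this
      exact this
    have h2 := hr.clm_apply (h1.prodMk (hasFDerivAt_const (0 : E) p))
    have h3 : adAction E (e.symm p) y = y := by rw [hsymm, adAction_one]; rfl
    rw [h3] at h2
    have h4 := (hlv y).unique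
      (h2.congr_of_eventuallyEq (eventually_fderiv_chartMul_adAction (G := G) y))
    have h5 := congrArg (fun T : E →L[ℝ] E => T x) h4
    have h6 : S (x, 0) (0, y) = D (p, p) (A' x y, 0) + S (0, x) (y, 0) := h5
    have h7 : D (p, p) (A' x y, 0) = A' x y := fderiv_chartMul_left (G := G) (A' x y)
    rw [h6, h7, hSsymm (y, 0)]
    abel
  refine Eq.trans ?_ (groupLieAlgebra_bracket_eq x y).symm
  change A' x y = fderiv ℝ (mpullbackWithin 𝓘(ℝ, E) 𝓘(ℝ, E) e.symm
      (mulInvariantVectorField y) (Set.range 𝓘(ℝ, E)) : E → E) p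
        (mpullbackWithin 𝓘(ℝ, E) 𝓘(ℝ, E) e.symm
      (mulInvariantVectorField x) (Set.range 𝓘(ℝ, E)) p : E) -
    fderiv ℝ (mpullbackWithin 𝓘(ℝ, E) 𝓘(ℝ, E) e.symm
      (mulInvariantVectorField x) (Set.range 𝓘(ℝ, E)) : E → E) p
        (mpullbackWithin 𝓘(ℝ, E) 𝓘(ℝ, E) e.symm
      (mulInvariantVectorField y) (Set.range 𝓘(ℝ, E)) p : E)
  rw [hval, hval, hbr, hbr]
  exact hkey x y

end AdjointDerivative

/-! ### Averaging bilinear forms over a compact space -/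

section IntegralForm

variable {G : Type*} [TopologicalSpace G] [CompactSpace G] [MeasurableSpace G] [BorelSpace G]

theorem integrable_of_continuous {A : Type*} [NormedAddCommGroup A] (μ : Measure G)
    [IsFiniteMeasure μ] {f : G → A} (hf : Continuous f) : Integrable f μ :=
  hf.integrable_of_hasCompactSupport (HasCompactSupport.of_compactSpace f)

/-- The integral of a continuous family of bilinear forms. -/
noncomputable def integralForm {W : Type*} [AddCommGroup W] [Module ℝ W] (μ : Measure G)
    [IsFiniteMeasure μ] (β : G → LinearMap.BilinForm ℝ W)
    (hβ : ∀ x y, Continuous fun g => β g x y) : LinearMap.BilinForm ℝ W :=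
  LinearMap.mk₂ ℝ (fun x y => ∫ g, β g x y ∂μ)
    (fun x x' y => by
      simp only [map_add, LinearMap.add_apply]
      exact integral_add (integrable_of_continuous μ (hβ x y))
        (integrable_of_continuous μ (hβ x' y)))
    (fun c x y => by
      simp only [map_smul, LinearMap.smul_apply]
      exact integral_smul c _)
    (fun x y y' => by
      simp only [map_add]
      exact integral_add (integrable_of_continuous μ (hβ x y))
        (integrable_of_continuous μ (hβ x y')))
    (fun c x y => by
      simp only [map_smul]
      exact integral_smul c _)

end IntegralForm

theorem exists_continuous_bilinear {W : Type*} [NormedAddCommGroup W] [NormedSpace ℝ W]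
    [FiniteDimensional ℝ W] (B : LinearMap.BilinForm ℝ W) :
    ∃ L : W →L[ℝ] W →L[ℝ] ℝ, ∀ x y, L x y = B x y :=
  ⟨LinearMap.toContinuousLinearMap (LinearMap.toContinuousLinearMap.toLinearMap ∘ₗ B),
    fun _ _ => rfl⟩

theorem exists_pos_symm_bilinForm (W : Type*) [AddCommGroup W] [Module ℝ W]
    [FiniteDimensional ℝ W] :
    ∃ B : LinearMap.BilinForm ℝ W, (∀ x y, B x y = B y x) ∧ ∀ x, x ≠ 0 → 0 < B x x := by
  let b := Module.finBasis ℝ W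
  let B : LinearMap.BilinForm ℝ W := LinearMap.mk₂ ℝ (fun x y => ∑ i, b.repr x i * b.repr y i)
    (fun x x' y => by simp [add_mul, Finset.sum_add_distrib])
    (fun c x y => by simp [Finset.mul_sum, mul_assoc])
    (fun x y y' => by simp [mul_add, Finset.sum_add_distrib])
    (fun c x y => by simp [Finset.mul_sum, mul_left_comm])
  refine ⟨B, fun x y => ?_, fun x hx => ?_⟩
  · exact Finset.sum_congr (s₁ := Finset.univ) rfl fun i _ => mul_comm (b.repr x i) (b.repr y i)
  · have h0 : ∀ i ∈ Finset.univ, 0 ≤ b.repr x i * b.repr x i := fun i _ => mul_self_nonneg _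
    refine lt_of_le_of_ne (Finset.sum_nonneg h0) fun h => hx ?_
    have h1 := (Finset.sum_eq_zero_iff_of_nonneg h0).1 h.symm
    apply b.repr.injective
    ext i
    simpa using h1 i (Finset.mem_univ i)

/-! ### An invariant inner product on the Lie algebra -/

section InvariantForm

variable {E : Type*} [NormedAddCommGroup E] [NormedSpace ℝ E] [FiniteDimensional ℝ E]
  {G : Type*} [TopologicalSpace G] [ChartedSpace E G] [Group G] [LieGroup 𝓘(ℝ, E) ∞ G]

instance : FiniteDimensional ℝ (GroupLieAlgebra 𝓘(ℝ, E) G) :=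
  inferInstanceAs (FiniteDimensional ℝ E)

/-- A bilinear form invariant under the adjoint representation is invariant under the bracket. -/
theorem lieInvariant_of_adAction (B : LinearMap.BilinForm ℝ E)
    (hB : ∀ (g : G) x y, B (adAction E g x) (adAction E g y) = B x y)
    (z x y : GroupLieAlgebra 𝓘(ℝ, E) G) :
    B (⁅z, x⁆ : GroupLieAlgebra 𝓘(ℝ, E) G) y = - B x (⁅z, y⁆ : GroupLieAlgebra 𝓘(ℝ, E) G) := by
  obtain ⟨A', hA', hbr⟩ := exists_hasFDerivAt_adAction (E := E) (G := G)
  obtain ⟨L, hL⟩ := exists_continuous_bilinear B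
  have key : ∀ z x y : E, B (A' z x) y = - B x (A' z y) := by
    intro z x y
    rw [← hL, ← hL, eq_neg_iff_add_eq_zero]
    have h1 := L.hasFDerivAt_of_bilinear (hA'.clm_apply (hasFDerivAt_const x _))
      (hA'.clm_apply (hasFDerivAt_const y _))
    have h2 : (fun a : E => L (adAction E ((extChartAt 𝓘(ℝ, E) (1 : G)).symm a) x)
        (adAction E ((extChartAt 𝓘(ℝ, E) (1 : G)).symm a) y)) = fun _ => L x y := by
      funext a
      rw [hL, hB, hL]
    rw [h2] at h1
    have h3 := congrArg (fun T : E →L[ℝ] ℝ => T z) (h1.unique (hasFDerivAt_const (L x y) _))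
    have h4 : adAction E ((extChartAt 𝓘(ℝ, E) (1 : G)).symm (extChartAt 𝓘(ℝ, E) (1 : G) 1)) =
        ContinuousLinearMap.id ℝ E := by
      rw [extChartAt_to_inv (I := 𝓘(ℝ, E)) (1 : G), adAction_one]
    rw [h4] at h3
    simp at h3
    rw [← h3]
    abel
  have h2 := key z x y
  have h3 := hbr z x
  have h4 := hbr z y
  exact h3 ▸ h4 ▸ h2

/-- Weyl's averaging: integrate an arbitrary inner product along `adAction E g⁻¹`. The inverse makes
left invariance of `μ` sufficient, since `(k g)⁻¹ k = g⁻¹`. Positivity survives because each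
`adAction E g` is injective. -/
theorem exists_invariant_form [CompactSpace G] [MeasurableSpace G] [BorelSpace G]
    (μ : Measure G) [μ.IsHaarMeasure] [IsProbabilityMeasure μ] :
    ∃ Φ : LinearMap.BilinForm ℝ (GroupLieAlgebra 𝓘(ℝ, E) G), (∀ x y, Φ x y = Φ y x) ∧
      (∀ x, x ≠ 0 → 0 < Φ x x) ∧ Φ.lieInvariant (GroupLieAlgebra 𝓘(ℝ, E) G) := by
  have : IsTopologicalGroup G := topologicalGroup_of_lieGroup 𝓘(ℝ, E) ∞
  obtain ⟨B, hBs, hBp⟩ := exists_pos_symm_bilinForm E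
  obtain ⟨L, hL⟩ := exists_continuous_bilinear B
  have hc : Continuous fun g : G => adAction E g⁻¹ :=
    (contMDiff_adAction (E := E) (G := G)).continuous.comp continuous_inv
  let T : G → E →ₗ[ℝ] E := fun g => (adAction E g⁻¹ : E →L[ℝ] E)
  have hβ : ∀ x y : E, Continuous fun g : G => B.compl₁₂ (T g) (T g) x y := by
    intro x y
    have : Continuous fun g : G => L (adAction E g⁻¹ x) (adAction E g⁻¹ y) := by fun_prop
    exact this.congr fun g => hL _ _
  let Φ : LinearMap.BilinForm ℝ E := integralForm μ (fun g => B.compl₁₂ (T g) (T g)) hβ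
  have hΦ : ∀ x y : E, Φ x y = ∫ g, B (adAction E g⁻¹ x) (adAction E g⁻¹ y) ∂μ := fun _ _ => rfl
  have hinj : ∀ (g : G) (x : E), adAction E g x = 0 → x = 0 := by
    intro g x hx
    have h1 := congrArg (fun S : E →L[ℝ] E => S x) (adAction_mul (E := E) g⁻¹ g)
    simp only [inv_mul_cancel, adAction_one, ContinuousLinearMap.comp_apply, hx, map_zero] at h1
    exact h1
  refine ⟨Φ, ?_, ?_, ?_⟩
  · intro x y
    refine (hΦ x y).trans (Eq.trans ?_ (hΦ y x).symm)
    exact integral_congr_ae (Filter.Eventually.of_forall fun g => hBs _ _)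
  · intro x hx
    have h1 : ∀ g : G, 0 < B (adAction E g⁻¹ x) (adAction E g⁻¹ x) :=
      fun g => hBp _ fun h => hx (hinj _ _ h)
    refine lt_of_lt_of_eq ?_ (hΦ x x).symm
    rw [integral_pos_iff_support_of_nonneg (fun g => (h1 g).le)
      (integrable_of_continuous μ (hβ x x))]
    have h2 : Function.support (fun g : G => B (adAction E g⁻¹ x) (adAction E g⁻¹ x)) =
        Set.univ := by
      ext g; simpa using (h1 g).ne'
    rw [h2, measure_univ]
    exact zero_lt_one
  · refine lieInvariant_of_adAction (G := G) Φ fun k x y => ?_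
    rw [hΦ, hΦ, ← integral_mul_left_eq_self _ k]
    refine integral_congr_ae (Filter.Eventually.of_forall fun g => ?_)
    have h1 : ∀ x : E, adAction E (k * g)⁻¹ (adAction E k x) = adAction E g⁻¹ x := by
      intro x
      have h2 := congrArg (fun S : E →L[ℝ] E => S x) (adAction_mul (E := E) (k * g)⁻¹ k)
      simp only [mul_inv_rev, inv_mul_cancel_right, ContinuousLinearMap.comp_apply] at h2
      rw [mul_inv_rev]
      exact h2.symm
    change B (adAction E (k * g)⁻¹ (adAction E k x)) (adAction E (k * g)⁻¹ (adAction E k y)) = _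
    rw [h1, h1]

end InvariantForm

/-! ### The Frobenius form and its orthogonal projections -/

section FrobeniusForm

variable {V : Type*} [NormedAddCommGroup V] [InnerProductSpace ℂ V] [FiniteDimensional ℂ V]

theorem tr_mul_comm (A B : V →L[ℂ] V) : tr (A * B) = tr (B * A) :=
  LinearMap.trace_mul_comm ℂ (A : V →ₗ[ℂ] V) (B : V →ₗ[ℂ] V)

theorem tr_sub (A B : V →L[ℂ] V) : tr (A - B) = tr A - tr B := by simp [tr]

theorem tr_smul (c : ℂ) (A : V →L[ℂ] V) : tr (c • A) = c * tr A := by simp [tr]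

theorem frobeniusForm_apply (A B : V →L[ℂ] V) : frobeniusForm V A B = (tr (star A * B)).re := rfl

theorem frobeniusForm_comm (A B : V →L[ℂ] V) : frobeniusForm V A B = frobeniusForm V B A := by
  simp only [frobeniusForm_eq_sum]
  exact Finset.sum_congr rfl fun i _ => inner_re_symm (𝕜 := ℂ) _ _

theorem frobeniusForm_pos (A : V →L[ℂ] V) (hA : A ≠ 0) : 0 < frobeniusForm V A A := by
  have hnn : ∀ i ∈ Finset.univ, 0 ≤ (inner ℂ (A (stdOrthonormalBasis ℂ V i))
      (A (stdOrthonormalBasis ℂ V i))).re := fun i _ => inner_self_nonneg (𝕜 := ℂ)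
  refine lt_of_le_of_ne ?_ fun h => hA ?_
  · rw [frobeniusForm_eq_sum]
    exact Finset.sum_nonneg hnn
  · have h1 := isCompl_orthogonal_frobenius (ℝ ∙ A)
    refine (Submodule.disjoint_def.1 h1.disjoint) A (Submodule.mem_span_singleton_self A) ?_
    intro B hB
    obtain ⟨c, rfl⟩ := Submodule.mem_span_singleton.1 hB
    change frobeniusForm V (c • A) A = 0
    simp [← h]

theorem frobeniusForm_lie (X A B : V →L[ℂ] V) (hX : star X = -X) :
    frobeniusForm V ⁅X, A⁆ B = - frobeniusForm V A ⁅X, B⁆ := by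
  simp only [frobeniusForm_apply, LieRing.of_associative_ring_bracket, star_sub, star_mul, hX]
  have h1 : (star A * -X - -X * star A) * B = -(star A * (X * B)) + X * (star A * B) := by
    noncomm_ring
  have h2 : star A * (X * B - B * X) = star A * (X * B) - star A * B * X := by noncomm_ring
  rw [h1, h2, tr_sub, tr_mul_comm (star A * B) X, ← Complex.neg_re, neg_sub]
  congr 1
  rw [neg_add_eq_sub, tr_sub]

theorem frobeniusForm_conj (u : unitary (V →L[ℂ] V)) (A B : V →L[ℂ] V) :
    frobeniusForm V ((u : V →L[ℂ] V) * A * star (u : V →L[ℂ] V))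
      ((u : V →L[ℂ] V) * B * star (u : V →L[ℂ] V)) = frobeniusForm V A B := by
  have hu : star (u : V →L[ℂ] V) * u = 1 := Unitary.coe_star_mul_self u
  simp only [frobeniusForm_apply, star_mul, star_star]
  have h1 : (u : V →L[ℂ] V) * (star A * star (u : V →L[ℂ] V)) *
      ((u : V →L[ℂ] V) * B * star (u : V →L[ℂ] V)) =
      u * (star A * (star (u : V →L[ℂ] V) * u) * B * star (u : V →L[ℂ] V)) := by
    noncomm_ring
  rw [h1, tr_mul_comm, hu, mul_one, mul_assoc, hu, mul_one]

theorem frobeniusProj_mem (W : Submodule ℝ (V →L[ℂ] V)) (A : V →L[ℂ] V) :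
    frobeniusProj W A ∈ W := Submodule.projection_apply_mem _ A

theorem frobeniusForm_sub_frobeniusProj (W : Submodule ℝ (V →L[ℂ] V)) (A B : V →L[ℂ] V)
    (hB : B ∈ W) : frobeniusForm V B (A - frobeniusProj W A) = 0 := by
  have h : A - frobeniusProj W A ∈ (frobeniusForm V).orthogonal W := by
    exact Submodule.sub_projection_mem _ A
  exact h B hB

theorem frobeniusProj_eq (W : Submodule ℝ (V →L[ℂ] V)) (A B : V →L[ℂ] V)
    (hB : B ∈ W) (h : ∀ C ∈ W, frobeniusForm V C (A - B) = 0) : frobeniusProj W A = B := by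
  rw [← sub_eq_zero]
  by_contra hne
  have hm : frobeniusProj W A - B ∈ W := sub_mem (frobeniusProj_mem W A) hB
  refine (frobeniusForm_pos _ hne).ne' ?_
  have h1 := h _ hm
  have h2 := frobeniusForm_sub_frobeniusProj W A _ hm
  have h3 : frobeniusProj W A - B = (A - B) - (A - frobeniusProj W A) := by abel
  calc frobeniusForm V (frobeniusProj W A - B) (frobeniusProj W A - B)
      = frobeniusForm V (frobeniusProj W A - B) ((A - B) - (A - frobeniusProj W A)) := by
        rw [← h3]
    _ = 0 := by rw [map_sub, h1, h2, sub_zero]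

theorem frobeniusProj_of_mem (W : Submodule ℝ (V →L[ℂ] V)) (A : V →L[ℂ] V) (hA : A ∈ W) :
    frobeniusProj W A = A :=
  frobeniusProj_eq W A A hA fun C _ => by simp

theorem frobeniusProj_eq_zero (W : Submodule ℝ (V →L[ℂ] V)) (A : V →L[ℂ] V)
    (h : ∀ C ∈ W, frobeniusForm V C A = 0) : frobeniusProj W A = 0 :=
  frobeniusProj_eq W A 0 W.zero_mem fun C hC => by simpa using h C hC

theorem frobeniusForm_frobeniusProj (W : Submodule ℝ (V →L[ℂ] V)) (A B : V →L[ℂ] V)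
    (hB : B ∈ W) : frobeniusForm V B (frobeniusProj W A) = frobeniusForm V B A := by
  have := frobeniusForm_sub_frobeniusProj W A B hB
  rw [map_sub, sub_eq_zero] at this
  exact this.symm

theorem frobeniusForm_frobeniusProj_left (W : Submodule ℝ (V →L[ℂ] V)) (A B : V →L[ℂ] V)
    (hB : B ∈ W) : frobeniusForm V (frobeniusProj W A) B = frobeniusForm V A B := by
  rw [frobeniusForm_comm, frobeniusForm_frobeniusProj W A B hB, frobeniusForm_comm]

/-- The projection onto a subspace stable under `ad X`, `X` skew-Hermitian, commutes with
`ad X`. -/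
theorem frobeniusProj_lie (W : Submodule ℝ (V →L[ℂ] V)) (X A : V →L[ℂ] V) (hX : star X = -X)
    (hW : ∀ B ∈ W, ⁅X, B⁆ ∈ W) : frobeniusProj W ⁅X, A⁆ = ⁅X, frobeniusProj W A⁆ := by
  refine frobeniusProj_eq W _ _ (hW _ (frobeniusProj_mem W A)) fun C hC => ?_
  rw [← lie_sub, ← neg_eq_zero, ← frobeniusForm_lie X _ _ hX]
  exact frobeniusForm_sub_frobeniusProj W A _ (hW C hC)

end FrobeniusForm

/-! ### Derivatives of conjugation at the identity operator -/

section StarConjugation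

variable {A : Type*} [NormedRing A] [StarRing A] [NormedStarGroup A] [NormedAlgebra ℝ A]
  [StarModule ℝ A]

/-- On skew elements, `star w = -w`, this derivative is the commutator `[w, a]`. -/
theorem hasFDerivAt_mul_mul_star (a : A) :
    ∃ q : A →L[ℝ] A, HasFDerivAt (fun u : A => u * a * star u) q 1 ∧
      ∀ w, q w = w * a + a * star w := by
  have h1 : HasFDerivAt (fun u : A => u) (ContinuousLinearMap.id ℝ A) 1 := hasFDerivAt_id _
  have h2 := (h1.mul_const' a).mul' h1.star
  refine ⟨_, h2, fun w => ?_⟩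
  simp
  abel

theorem hasFDerivAt_star_mul_mul (a : A) :
    ∃ q : A →L[ℝ] A, HasFDerivAt (fun u : A => star u * a * u) q 1 ∧
      ∀ w, q w = star w * a + a * w := by
  have h1 : HasFDerivAt (fun u : A => u) (ContinuousLinearMap.id ℝ A) 1 := hasFDerivAt_id _
  have h2 := (h1.star.mul_const' a).mul' h1
  refine ⟨_, h2, fun w => ?_⟩
  simp
  abel

/-- On skew elements the derivative is `[w, P a] - P [w, a]`, which measures the failure of `P` to
commute with `ad w`. -/
theorem hasFDerivAt_mul_comp_mul_star (P : A →L[ℝ] A) (a : A) :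
    ∃ q : A →L[ℝ] A, HasFDerivAt (fun u : A => u * P (star u * a * u) * star u) q 1 ∧
      ∀ w, q w = w * P a + P a * star w + P (star w * a + a * w) := by
  obtain ⟨q, hq, hqw⟩ := hasFDerivAt_star_mul_mul a
  have h1 : HasFDerivAt (fun u : A => u) (ContinuousLinearMap.id ℝ A) 1 := hasFDerivAt_id _
  have h2 := (h1.mul' (P.hasFDerivAt.comp 1 hq)).mul' h1.star
  refine ⟨_, h2, fun w => ?_⟩
  simp [hqw]
  abel

end StarConjugation

/-! ### Conjugation of operators by the group -/

section Representation

variable {G : Type*} [Group G]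
  {V : Type*} [NormedAddCommGroup V] [InnerProductSpace ℂ V] [FiniteDimensional ℂ V]

/-- The action of `G` on operators by conjugation. -/
noncomputable def conjRep (φ : G →* unitary (V →L[ℂ] V)) (g : G) :
    (V →L[ℂ] V) →ₗ[ℝ] (V →L[ℂ] V) :=
  LinearMap.mulLeft ℝ (φ g : V →L[ℂ] V) ∘ₗ LinearMap.mulRight ℝ (star (φ g : V →L[ℂ] V))

theorem conjRep_apply (φ : G →* unitary (V →L[ℂ] V)) (g : G) (A : V →L[ℂ] V) :
    conjRep φ g A = (φ g : V →L[ℂ] V) * A * star (φ g : V →L[ℂ] V) := by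
  simp [conjRep, mul_assoc]

theorem conjRep_inv_apply (φ : G →* unitary (V →L[ℂ] V)) (g : G) (A : V →L[ℂ] V) :
    conjRep φ g⁻¹ A = star (φ g : V →L[ℂ] V) * A * (φ g : V →L[ℂ] V) := by
  have h : (φ g⁻¹ : V →L[ℂ] V) = star (φ g : V →L[ℂ] V) := by
    rw [map_inv]; rfl
  rw [conjRep_apply, h, star_star]

theorem conjRep_mul (φ : G →* unitary (V →L[ℂ] V)) (g k : G) (A : V →L[ℂ] V) :
    conjRep φ (g * k) A = conjRep φ g (conjRep φ k A) := by
  simp [conjRep_apply, mul_assoc]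

theorem conjRep_one (φ : G →* unitary (V →L[ℂ] V)) (A : V →L[ℂ] V) :
    conjRep φ 1 A = A := by
  simp [conjRep_apply]

theorem frobeniusForm_conjRep (φ : G →* unitary (V →L[ℂ] V)) (g : G) (A B : V →L[ℂ] V) :
    frobeniusForm V (conjRep φ g A) (conjRep φ g B) = frobeniusForm V A B := by
  rw [conjRep_apply, conjRep_apply, frobeniusForm_conj]

/-- Together with left invariance of Haar measure, this makes the moments of `g A g⁻¹` invariant
under conjugation. -/
theorem frobeniusForm_conjRep_mul (φ : G →* unitary (V →L[ℂ] V)) (k g : G) (A B : V →L[ℂ] V) :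
    frobeniusForm V (conjRep φ (k * g) A) (conjRep φ k B) =
      frobeniusForm V (conjRep φ g A) B := by
  rw [conjRep_mul, frobeniusForm_conjRep]

end Representation

/-! ### Vanishing derivative on a connected manifold -/

section Connected

variable {E : Type*} [NormedAddCommGroup E] [NormedSpace ℝ E]
  {G : Type*} [TopologicalSpace G] [ChartedSpace E G]
  {A : Type*} [NormedAddCommGroup A] [NormedSpace ℝ A]

/-- On a connected manifold, a function with zero derivative is constant. -/
theorem eq_of_hasMFDerivAt_zero [IsManifold 𝓘(ℝ, E) ∞ G] [ConnectedSpace G] (f : G → A)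
    (hf : ∀ g, HasMFDerivAt 𝓘(ℝ, E) 𝓘(ℝ, A) f g (0 : E →L[ℝ] A)) (g k : G) : f g = f k := by
  have : IsManifold 𝓘(ℝ, E) 1 G := IsManifold.of_le (n := ∞) ENat.LEInfty.out
  refine IsLocallyConstant.apply_eq_of_preconnectedSpace ?_ g k
  rw [IsLocallyConstant.iff_eventually_eq]
  intro x
  set e := extChartAt 𝓘(ℝ, E) x with he
  have hrange : (Set.range 𝓘(ℝ, E)) = Set.univ := by simp
  have hd : ∀ a ∈ e.target, HasFDerivAt (f ∘ e.symm) (0 : E →L[ℝ] A) a := by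
    intro a ha
    have h := (mdifferentiableWithinAt_extChartAt_symm (I := 𝓘(ℝ, E)) ha).hasMFDerivWithinAt
    rw [hrange] at h
    have h1 := HasMFDerivAt.comp (x := a) (hf (e.symm a)) (hasMFDerivWithinAt_univ.1 h)
    have h2 := hasMFDerivAt_iff_hasFDerivAt.1 h1
    refine h2.congr_fderiv ?_
    ext v
    rfl
  have htgt : e.target ∈ nhds (e x) := extChartAt_target_mem_nhds (I := 𝓘(ℝ, E)) x
  obtain ⟨r, hr, hball⟩ := Metric.mem_nhds_iff.1 htgt
  have hconst : ∀ a ∈ Metric.ball (e x) r, (f ∘ e.symm) a = (f ∘ e.symm) (e x) := by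
    intro a ha
    refine (convex_ball (e x) r).is_const_of_fderivWithin_eq_zero (𝕜 := ℝ)
      (fun b hb => (hd b (hball hb)).differentiableAt.differentiableWithinAt) (fun b hb => ?_) ha
      (Metric.mem_ball_self hr)
    rw [fderivWithin_of_isOpen Metric.isOpen_ball hb]
    exact (hd b (hball hb)).fderiv
  have hc : ContinuousAt e x := continuousAt_extChartAt x
  filter_upwards [hc.preimage_mem_nhds (Metric.ball_mem_nhds _ hr),
    extChartAt_source_mem_nhds (I := 𝓘(ℝ, E)) x] with y hy hys
  have h1 := hconst _ hy
  simp only [Function.comp] at h1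
  rwa [PartialEquiv.left_inv _ hys, PartialEquiv.left_inv _ (mem_extChartAt_source x)] at h1

end Connected

/-! ### From invariance under the group to invariance under commutators -/

section SmoothRepresentation

variable {E : Type*} [NormedAddCommGroup E] [NormedSpace ℝ E] [FiniteDimensional ℝ E]
  {G : Type*} [TopologicalSpace G] [ChartedSpace E G] [Group G] [LieGroup 𝓘(ℝ, E) ∞ G]
  {V : Type*} [NormedAddCommGroup V] [InnerProductSpace ℂ V] [FiniteDimensional ℂ V]
  (φ : G →* unitary (V →L[ℂ] V)) (hφ : IsSmoothRep E φ)

theorem exists_hasMFDerivAt_rep :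
    ∃ D : E →L[ℝ] (V →L[ℂ] V),
      HasMFDerivAt 𝓘(ℝ, E) 𝓘(ℝ, V →L[ℂ] V) (fun g : G => (φ g : V →L[ℂ] V)) 1 D ∧
        ∀ z : GroupLieAlgebra 𝓘(ℝ, E) G, D z = dRep φ hφ z :=
  ⟨_, (hφ.mdifferentiable (by simp) 1).hasMFDerivAt, fun _ => rfl⟩

/-- Differentiating a function of `φ g` at `g = 1`. -/
theorem hasMFDerivAt_comp_rep {A : Type*} [NormedAddCommGroup A] [NormedSpace ℝ A]
    (f : (V →L[ℂ] V) → A) (q : (V →L[ℂ] V) →L[ℝ] A) (hq : HasFDerivAt f q 1) :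
    ∃ D : E →L[ℝ] A,
      HasMFDerivAt 𝓘(ℝ, E) 𝓘(ℝ, A) (fun g : G => f (φ g : V →L[ℂ] V)) 1 D ∧
        ∀ z : GroupLieAlgebra 𝓘(ℝ, E) G, D z = q (dRep φ hφ z) := by
  obtain ⟨D, hD, hDz⟩ := exists_hasMFDerivAt_rep φ hφ
  have h1 : HasMFDerivAt 𝓘(ℝ, V →L[ℂ] V) 𝓘(ℝ, A) f (φ 1 : V →L[ℂ] V) q := by
    have : (φ 1 : V →L[ℂ] V) = 1 := by simp
    rw [this]
    exact hq.hasMFDerivAt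
  exact ⟨q.comp D, HasMFDerivAt.comp (x := (1 : G)) (f := fun g : G => (φ g : V →L[ℂ] V)) h1 hD,
    fun z => congrArg q (hDz z)⟩

/-- The chain rule at `g = 1`. An identity holding on the whole group is turned by this into its
infinitesimal form. -/
theorem apply_dRep_eq_zero {A : Type*} [NormedAddCommGroup A] [NormedSpace ℝ A]
    (f : (V →L[ℂ] V) → A) (q : (V →L[ℂ] V) →L[ℝ] A) (hq : HasFDerivAt f q 1) (c : A)
    (hc : ∀ g : G, f (φ g : V →L[ℂ] V) = c) (z : GroupLieAlgebra 𝓘(ℝ, E) G) :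
    q (dRep φ hφ z) = 0 := by
  obtain ⟨D, hD, hDz⟩ := hasMFDerivAt_comp_rep φ hφ f q hq
  have hc' : (fun g : G => f (φ g : V →L[ℂ] V)) = fun _ => c := funext hc
  rw [hc'] at hD
  have h := hasMFDerivAt_unique hD (hasMFDerivAt_const c (1 : G))
  rw [← hDz, h]
  rfl

/-- Differentiate `u * star u = 1` at the identity. -/
theorem star_dRep (z : GroupLieAlgebra 𝓘(ℝ, E) G) :
    star (dRep φ hφ z) = - dRep φ hφ z := by
  obtain ⟨q, hq, hqw⟩ := hasFDerivAt_mul_mul_star (1 : V →L[ℂ] V)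
  have h := apply_dRep_eq_zero φ hφ _ q hq 1 (fun g => by simp) z
  rw [hqw, mul_one, one_mul, add_comm] at h
  exact eq_neg_of_add_eq_zero_left h

/-- A linear form invariant under conjugation vanishes on commutators. -/
theorem apply_lie_dRep_eq_zero (m : (V →L[ℂ] V) →ₗ[ℝ] ℝ)
    (hm : ∀ (g : G) A, m (conjRep φ g A) = m A) (z : GroupLieAlgebra 𝓘(ℝ, E) G) (A : V →L[ℂ] V) :
    m ⁅dRep φ hφ z, A⁆ = 0 := by
  obtain ⟨q, hq, hqw⟩ := hasFDerivAt_mul_mul_star A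
  let L := LinearMap.toContinuousLinearMap m
  have h := apply_dRep_eq_zero φ hφ _ (L.comp q) (L.hasFDerivAt.comp 1 hq) (m A)
    (fun g => by
      change m ((φ g : V →L[ℂ] V) * A * star (φ g : V →L[ℂ] V)) = m A
      rw [← conjRep_apply, hm]) z
  have h1 : m (q (dRep φ hφ z)) = 0 := h
  rw [hqw, star_dRep, mul_neg, ← sub_eq_add_neg] at h1
  exact h1

/-- A bilinear form invariant under conjugation is invariant under commutators. -/
theorem bilin_lie_dRep (B : LinearMap.BilinForm ℝ (V →L[ℂ] V))
    (hB : ∀ (g : G) A A', B (conjRep φ g A) (conjRep φ g A') = B A A')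
    (z : GroupLieAlgebra 𝓘(ℝ, E) G) (A A' : V →L[ℂ] V) :
    B ⁅dRep φ hφ z, A⁆ A' = - B A ⁅dRep φ hφ z, A'⁆ := by
  obtain ⟨q, hq, hqw⟩ := hasFDerivAt_mul_mul_star A
  obtain ⟨q', hq', hqw'⟩ := hasFDerivAt_mul_mul_star A'
  obtain ⟨L, hL⟩ := exists_continuous_bilinear B
  have h := apply_dRep_eq_zero φ hφ _ _ (L.hasFDerivAt_of_bilinear hq hq') (B A A')
    (fun g => by
      rw [hL, ← conjRep_apply, ← conjRep_apply, hB]) z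
  have h1 : L (1 * A * star 1) (q' (dRep φ hφ z)) + L (q (dRep φ hφ z)) (1 * A' * star 1) = 0 := h
  rw [hqw, hqw', star_dRep, mul_neg, mul_neg, ← sub_eq_add_neg, ← sub_eq_add_neg, hL, hL] at h1
  simp only [one_mul, star_one, mul_one] at h1
  rw [eq_neg_iff_add_eq_zero, add_comm]
  exact h1

/-- The projection onto a subspace stable under commutators with `dφ(𝔤)` commutes with
conjugation. -/
theorem frobeniusProj_conjRep [ConnectedSpace G] (W : Submodule ℝ (V →L[ℂ] V))
    (hW : ∀ (z : GroupLieAlgebra 𝓘(ℝ, E) G), ∀ B ∈ W, ⁅dRep φ hφ z, B⁆ ∈ W) (g : G)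
    (A : V →L[ℂ] V) : frobeniusProj W (conjRep φ g A) = conjRep φ g (frobeniusProj W A) := by
  let P : (V →L[ℂ] V) →L[ℝ] (V →L[ℂ] V) := LinearMap.toContinuousLinearMap (frobeniusProj W)
  -- `Φ A g = g P(g⁻¹ A g) g⁻¹` is shown to have zero derivative everywhere, hence to be constant in
  -- `g` by connectedness; no exponential map is involved.
  let Φ : (V →L[ℂ] V) → G → (V →L[ℂ] V) := fun A g => conjRep φ g (P (conjRep φ g⁻¹ A))
  have h1 : ∀ A, HasMFDerivAt 𝓘(ℝ, E) 𝓘(ℝ, V →L[ℂ] V) (Φ A) 1 (0 : E →L[ℝ] (V →L[ℂ] V)) := by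
    intro A
    obtain ⟨q, hq, hqw⟩ := hasFDerivAt_mul_comp_mul_star P A
    obtain ⟨D, hD, hDz⟩ := hasMFDerivAt_comp_rep φ hφ _ q hq
    have h2 : (fun g : G => (φ g : V →L[ℂ] V) *
        P (star (φ g : V →L[ℂ] V) * A * (φ g : V →L[ℂ] V)) * star (φ g : V →L[ℂ] V)) = Φ A := by
      funext g
      simp only [Φ, conjRep_apply φ g, conjRep_inv_apply]
    have h3 : ∀ z : GroupLieAlgebra 𝓘(ℝ, E) G, q (dRep φ hφ z) = 0 := by
      intro z
      rw [hqw, star_dRep]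
      have h4 : P ⁅dRep φ hφ z, A⁆ = ⁅dRep φ hφ z, P A⁆ :=
        frobeniusProj_lie W _ A (star_dRep φ hφ z) (hW z)
      have h5 : -dRep φ hφ z * A + A * dRep φ hφ z = - ⁅dRep φ hφ z, A⁆ := by
        rw [LieRing.of_associative_ring_bracket]; noncomm_ring
      rw [h5, map_neg, h4, LieRing.of_associative_ring_bracket, mul_neg]
      abel
    rw [h2] at hD
    refine hD.congr_mfderiv ?_
    ext1 z
    exact (hDz z).trans (h3 z)
  have h2 : ∀ A g, HasMFDerivAt 𝓘(ℝ, E) 𝓘(ℝ, V →L[ℂ] V) (Φ A) g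
      (0 : E →L[ℝ] (V →L[ℂ] V)) := by
    intro A g
    let C : (V →L[ℂ] V) →L[ℝ] (V →L[ℂ] V) := LinearMap.toContinuousLinearMap (conjRep φ g)
    have h3 : HasMFDerivAt 𝓘(ℝ, E) 𝓘(ℝ, E) (fun k : G => g⁻¹ * k) g
        (mfderiv 𝓘(ℝ, E) 𝓘(ℝ, E) (fun k : G => g⁻¹ * k) g : E →L[ℝ] E) :=
      ((contMDiff_mul_left (I := 𝓘(ℝ, E)) (n := ∞) (a := g⁻¹)).mdifferentiable
        (by simp) g).hasMFDerivAt
    have h4 : HasMFDerivAt 𝓘(ℝ, E) 𝓘(ℝ, V →L[ℂ] V) (Φ (conjRep φ g⁻¹ A)) (g⁻¹ * g)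
        (0 : E →L[ℝ] (V →L[ℂ] V)) := by
      rw [inv_mul_cancel]; exact h1 _
    have h5 := HasMFDerivAt.comp (x := g) (C.hasFDerivAt.hasMFDerivAt)
      (HasMFDerivAt.comp (x := g) (f := fun k : G => g⁻¹ * k) h4 h3)
    -- Translation by `g` carries the derivative of `Φ A` at `g` back to a derivative at `1`, for
    -- the operator `g⁻¹ A g`.
    have h6 : (C ∘ (Φ (conjRep φ g⁻¹ A) ∘ fun k : G => g⁻¹ * k)) = Φ A := by
      funext k
      change conjRep φ g (conjRep φ (g⁻¹ * k) (P (conjRep φ (g⁻¹ * k)⁻¹ (conjRep φ g⁻¹ A)))) =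
        conjRep φ k (P (conjRep φ k⁻¹ A))
      rw [← conjRep_mul, ← conjRep_mul]
      simp
    rw [h6] at h5
    refine h5.congr_mfderiv ?_
    ext1 v
    change C 0 = 0
    simp
  have h3 := eq_of_hasMFDerivAt_zero (Φ (conjRep φ g A)) (h2 _) 1 g
  simp only [Φ, inv_one, conjRep_one, ← conjRep_mul, inv_mul_cancel, one_mul] at h3
  exact h3

end SmoothRepresentation

/-! ### Dual bases: Parseval and trace formulas -/

section DualBasis

variable {V : Type*} [NormedAddCommGroup V] [InnerProductSpace ℂ V] [FiniteDimensional ℂ V]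

theorem exists_frobenius_dual_basis (W : Submodule ℝ (V →L[ℂ] V)) :
    ∃ (b : Module.Basis (Fin (Module.finrank ℝ W)) ℝ W) (b' : Fin (Module.finrank ℝ W) → W),
      ∀ (Y : W) i, b.repr Y i = frobeniusForm V (b' i) Y := by
  let F : LinearMap.BilinForm ℝ W := (frobeniusForm V).restrict W
  have hF : F.Nondegenerate := by
    refine ⟨fun x h => ?_, fun x h => ?_⟩ <;>
    · by_contra hne
      exact (frobeniusForm_pos (x : V →L[ℂ] V) (by simpa using hne)).ne' (h x)
  let b := Module.finBasis ℝ W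
  refine ⟨b, F.dualBasis hF b, fun Y i => ?_⟩
  have h : ∀ j, F (F.dualBasis hF b i) (b j) = if j = i then 1 else 0 := fun j =>
    LinearMap.BilinForm.apply_dualBasis_left hF b i j
  have h2 : F (F.dualBasis hF b i) Y = b.repr Y i := by
    conv_lhs => rw [← b.sum_repr Y, map_sum]
    simp only [map_smul, h, smul_eq_mul, mul_ite, mul_one, mul_zero, Finset.sum_ite_eq',
      Finset.mem_univ, if_true]
  exact h2.symm

variable {W : Submodule ℝ (V →L[ℂ] V)} {ι : Type*} [Fintype ι] (b : Module.Basis ι ℝ W) (b' : ι → W)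
    (h : ∀ (Y : W) i, b.repr Y i = frobeniusForm V (b' i) Y)

include h

theorem sum_frobeniusForm_mul (A B : V →L[ℂ] V) (hB : B ∈ W) :
    ∑ i, frobeniusForm V A (b i) * frobeniusForm V (b' i) B = frobeniusForm V A B := by
  have h1 := congrArg (Subtype.val) (b.sum_repr ⟨B, hB⟩)
  simp only [Submodule.coe_sum, Submodule.coe_smul] at h1
  conv_rhs => rw [← h1]
  rw [map_sum]
  refine Finset.sum_congr rfl fun i _ => ?_
  rw [map_smul, h, smul_eq_mul, mul_comm]

theorem trace_eq_sum_frobeniusForm (T : W →ₗ[ℝ] W) :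
    LinearMap.trace ℝ W T = ∑ i, frobeniusForm V (b' i) (T (b i)) := by
  classical
  rw [LinearMap.trace_eq_matrix_trace ℝ b, Matrix.trace]
  refine Finset.sum_congr rfl fun i _ => ?_
  rw [Matrix.diag_apply, LinearMap.toMatrix_apply, h]

theorem sum_frobeniusForm_self :
    ∑ i, frobeniusForm V (b i) (b' i) = Fintype.card ι := by
  have h1 := trace_eq_sum_frobeniusForm b b' h LinearMap.id
  rw [LinearMap.trace_id, Module.finrank_eq_card_basis b] at h1
  rw [h1]
  exact Finset.sum_congr rfl fun i _ => frobeniusForm_comm _ _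

end DualBasis

/-! ### Images of ideals under the representation -/

section Ideals

variable {E : Type*} [NormedAddCommGroup E] [NormedSpace ℝ E] [FiniteDimensional ℝ E]
  {G : Type*} [TopologicalSpace G] [ChartedSpace E G] [Group G] [LieGroup 𝓘(ℝ, E) ∞ G]
  {V : Type*} [NormedAddCommGroup V] [InnerProductSpace ℂ V] [FiniteDimensional ℂ V]
  (φ : G →* unitary (V →L[ℂ] V)) (hφ : IsSmoothRep E φ)
  {𝔞 𝔟 : LieIdeal ℝ (GroupLieAlgebra 𝓘(ℝ, E) G)}

theorem mem_dRepIdeal {A : V →L[ℂ] V} :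
    A ∈ dRepIdeal φ hφ 𝔞 ↔ ∃ x ∈ 𝔞, dRep φ hφ x = A := Iff.rfl

theorem dRep_mem_dRepIdeal {x : GroupLieAlgebra 𝓘(ℝ, E) G} (hx : x ∈ 𝔞) :
    dRep φ hφ x ∈ dRepIdeal φ hφ 𝔞 := ⟨x, hx, rfl⟩

theorem lie_dRep_mem_dRepIdeal (z : GroupLieAlgebra 𝓘(ℝ, E) G) {A : V →L[ℂ] V}
    (hA : A ∈ dRepIdeal φ hφ 𝔞) : ⁅dRep φ hφ z, A⁆ ∈ dRepIdeal φ hφ 𝔞 := by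
  obtain ⟨x, hx, rfl⟩ := (mem_dRepIdeal φ hφ).1 hA
  rw [← LieHom.map_lie]
  exact dRep_mem_dRepIdeal φ hφ (lie_mem_right ℝ _ 𝔞 z x hx)

/-- The image of a simple ideal is spanned by commutators. -/
theorem dRepIdeal_le_of_lie_mem [LieAlgebra.IsSimple ℝ 𝔞] (N : Submodule ℝ (V →L[ℂ] V))
    (hN : ∀ x ∈ 𝔞, ∀ y ∈ 𝔞, ⁅dRep φ hφ x, dRep φ hφ y⁆ ∈ N) {A : V →L[ℂ] V}
    (hA : A ∈ dRepIdeal φ hφ 𝔞) : A ∈ N := by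
  obtain ⟨x, hx, rfl⟩ := (mem_dRepIdeal φ hφ).1 hA
  have h1 : (⟨x, hx⟩ : 𝔞) ∈ Submodule.span ℝ {z : 𝔞 | ∃ x y : 𝔞, ⁅x, y⁆ = z} := by
    rw [span_lie_eq_top_of_isSimple]; trivial
  have h2 : ∀ z : 𝔞, z ∈ Submodule.span ℝ {z : 𝔞 | ∃ x y : 𝔞, ⁅x, y⁆ = z} →
      dRep φ hφ z ∈ N := by
    intro z hz
    induction hz using Submodule.span_induction with
    | mem z hz =>
      obtain ⟨u, v, rfl⟩ := hz
      have h3 := hN u u.2 v v.2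
      rw [← LieHom.map_lie] at h3
      exact h3
    | zero => simp
    | add u v _ _ hu hv =>
      rw [LieSubmodule.coe_add, map_add]
      exact N.add_mem hu hv
    | smul c u _ hu =>
      rw [LieSubmodule.coe_smul, map_smul]
      exact N.smul_mem c hu
  exact h2 _ h1

/-- By perfectness take `A = [u, v]` in the image of `𝔞`; then `B([u, v], y) = -B(v, [u, y]) = 0`.
It serves for the Frobenius form and for the second moment, and `𝔟` may be the center. -/
theorem bilin_eq_zero_of_lie_eq_zero [LieAlgebra.IsSimple ℝ 𝔞]
    (B : LinearMap.BilinForm ℝ (V →L[ℂ] V))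
    (hB : ∀ (z : GroupLieAlgebra 𝓘(ℝ, E) G) (A A' : V →L[ℂ] V),
      B ⁅dRep φ hφ z, A⁆ A' = - B A ⁅dRep φ hφ z, A'⁆)
    (hab : ∀ x ∈ 𝔞, ∀ y ∈ 𝔟, ⁅x, y⁆ = 0) {A A' : V →L[ℂ] V}
    (hA : A ∈ dRepIdeal φ hφ 𝔞) (hA' : A' ∈ dRepIdeal φ hφ 𝔟) : B A A' = 0 := by
  obtain ⟨y, hy, rfl⟩ := (mem_dRepIdeal φ hφ).1 hA'
  refine dRepIdeal_le_of_lie_mem φ hφ (LinearMap.ker (B.flip (dRep φ hφ y)))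
    (fun u hu v _ => ?_) hA
  have h1 : B ⁅dRep φ hφ u, dRep φ hφ v⁆ (dRep φ hφ y) = 0 := by
    rw [hB, ← LieHom.map_lie, hab u hu y hy]
    simp
  exact h1

theorem frobeniusForm_lie_dRep (z : GroupLieAlgebra 𝓘(ℝ, E) G) (A A' : V →L[ℂ] V) :
    frobeniusForm V ⁅dRep φ hφ z, A⁆ A' = - frobeniusForm V A ⁅dRep φ hφ z, A'⁆ :=
  frobeniusForm_lie _ _ _ (star_dRep φ hφ z)

/-- A simple ideal is represented either faithfully or trivially. -/
theorem dRep_injOn_or_eq_zero [hs : LieAlgebra.IsSimple ℝ 𝔞] :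
    (∀ x ∈ 𝔞, dRep φ hφ x = 0 → x = 0) ∨ ∀ x ∈ 𝔞, dRep φ hφ x = 0 := by
  let I : LieIdeal ℝ 𝔞 :=
    { carrier := {x : 𝔞 | dRep φ hφ x = 0}
      add_mem' := fun {a b} ha hb => by
        change dRep φ hφ ((a : GroupLieAlgebra 𝓘(ℝ, E) G) + b) = 0
        rw [map_add, ha, hb, add_zero]
      zero_mem' := by simp
      smul_mem' := fun r x hx => by
        change dRep φ hφ (r • (x : GroupLieAlgebra 𝓘(ℝ, E) G)) = 0
        rw [map_smul, hx, smul_zero]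
      lie_mem := fun {z x} hx => by
        change dRep φ hφ ⁅(z : GroupLieAlgebra 𝓘(ℝ, E) G), (x : GroupLieAlgebra 𝓘(ℝ, E) G)⁆ = 0
        have hx' : dRep φ hφ (x : GroupLieAlgebra 𝓘(ℝ, E) G) = 0 := hx
        rw [LieHom.map_lie, hx', lie_zero] }
  have hI : ∀ x : 𝔞, x ∈ I ↔ dRep φ hφ x = 0 := fun _ => Iff.rfl
  rcases hs.eq_bot_or_eq_top I with h | h
  · left
    intro x hx h0
    have h1 : (⟨x, hx⟩ : 𝔞) ∈ I := (hI _).2 h0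
    rw [h, LieSubmodule.mem_bot] at h1
    exact congrArg Subtype.val h1
  · right
    intro x hx
    refine (hI ⟨x, hx⟩).1 ?_
    rw [h]
    exact LieSubmodule.mem_top _

theorem finrank_dRepIdeal (h : ∀ x ∈ 𝔞, dRep φ hφ x = 0 → x = 0) :
    Module.finrank ℝ (dRepIdeal φ hφ 𝔞).toSubmodule = Module.finrank ℝ 𝔞 := by
  let ψ : 𝔞 →ₗ[ℝ] (dRepIdeal φ hφ 𝔞).toSubmodule :=
    { toFun := fun x => ⟨dRep φ hφ x, dRep_mem_dRepIdeal φ hφ x.2⟩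
      map_add' := fun x y => Subtype.ext (map_add _ _ _)
      map_smul' := fun c x => Subtype.ext (map_smul _ _ _) }
  refine (LinearEquiv.finrank_eq (LinearEquiv.ofBijective ψ ⟨?_, ?_⟩)).symm
  · rw [← LinearMap.ker_eq_bot, LinearMap.ker_eq_bot']
    intro x hx
    exact Subtype.ext (h x x.2 (congrArg Subtype.val hx))
  · rintro ⟨_, x, hx, rfl⟩
    exact ⟨⟨x, hx⟩, rfl⟩

/-- On the image of a simple ideal, an invariant symmetric form is a multiple of the Frobenius
inner product. -/
theorem exists_eq_mul_frobeniusForm [LieAlgebra.IsSimple ℝ 𝔞]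
    (h : ∀ x ∈ 𝔞, dRep φ hφ x = 0 → x = 0) (B : LinearMap.BilinForm ℝ (V →L[ℂ] V))
    (hBs : ∀ A A', B A A' = B A' A)
    (hB : ∀ (z : GroupLieAlgebra 𝓘(ℝ, E) G) (A A' : V →L[ℂ] V),
      B ⁅dRep φ hφ z, A⁆ A' = - B A ⁅dRep φ hφ z, A'⁆) :
    ∃ c : ℝ, ∀ A ∈ dRepIdeal φ hφ 𝔞, ∀ A' ∈ dRepIdeal φ hφ 𝔞,
      B A A' = c * frobeniusForm V A A' := by
  -- Both forms are pulled back to `𝔞`, where Schur's lemma applies; faithfulness keeps the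
  -- Frobenius form positive definite.
  let ψ : 𝔞 →ₗ[ℝ] (V →L[ℂ] V) := (dRep φ hφ).toLinearMap ∘ₗ 𝔞.toSubmodule.subtype
  have hψ : ∀ x : 𝔞, ψ x = dRep φ hφ x := fun _ => rfl
  have hlie : ∀ x y : 𝔞, ψ ⁅x, y⁆ = ⁅dRep φ hφ x, ψ y⁆ := fun x y =>
    LieHom.map_lie (dRep φ hφ) (x : GroupLieAlgebra 𝓘(ℝ, E) G) y
  obtain ⟨c, hc⟩ := exists_eq_smul_of_isSimple ((frobeniusForm V).compl₁₂ ψ ψ)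
    (B.compl₁₂ ψ ψ) (fun x y => frobeniusForm_comm _ _)
    (fun x hx => frobeniusForm_pos _ fun h0 => hx (Subtype.ext (h x x.2 h0)))
    (fun x y z => by
      simp only [LinearMap.compl₁₂_apply, hlie]
      exact frobeniusForm_lie_dRep φ hφ _ _ _)
    (fun x y => hBs _ _)
    (fun x y z => by
      simp only [LinearMap.compl₁₂_apply, hlie]
      exact hB _ _ _)
  refine ⟨c, ?_⟩
  rintro _ ⟨x, hx, rfl⟩ _ ⟨y, hy, rfl⟩
  exact hc ⟨x, hx⟩ ⟨y, hy⟩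

end Ideals

/-- Compact groups are unimodular: right translates of `μ`, and then its inverse, are Haar
probability measures, hence equal to `μ` by uniqueness. -/
theorem isInvInvariant_of_compactSpace {G : Type*} [TopologicalSpace G] [Group G]
    [IsTopologicalGroup G] [CompactSpace G] [MeasurableSpace G] [BorelSpace G] (μ : Measure G)
    [μ.IsHaarMeasure] [IsProbabilityMeasure μ] : μ.IsInvInvariant := by
  have h1 : μ.IsMulRightInvariant := by
    refine ⟨fun g => ?_⟩
    have : IsProbabilityMeasure (μ.map (· * g)) :=
      Measure.isProbabilityMeasure_map (continuous_mul_const g).measurable.aemeasurable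
    exact Measure.isHaarMeasure_eq_of_isProbabilityMeasure _ _
  refine ⟨?_⟩
  have : IsProbabilityMeasure μ.inv :=
    Measure.isProbabilityMeasure_map continuous_inv.measurable.aemeasurable
  have : μ.inv.IsHaarMeasure :=
    { lt_top_of_isCompact := fun K _ => measure_lt_top _ _
      open_pos := fun U hU hne => by
        rw [Measure.inv_apply]
        exact (hU.inv.measure_pos μ hne.inv).ne' }
  exact Measure.isHaarMeasure_eq_of_isProbabilityMeasure _ _

/-! ### First and second moments of a random conjugate -/

section Moments

variable {E : Type*} [NormedAddCommGroup E] [NormedSpace ℝ E] [FiniteDimensional ℝ E]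
  {G : Type*} [TopologicalSpace G] [ChartedSpace E G] [Group G] [LieGroup 𝓘(ℝ, E) ∞ G]
  {V : Type*} [NormedAddCommGroup V] [InnerProductSpace ℂ V] [FiniteDimensional ℂ V]
  (φ : G →* unitary (V →L[ℂ] V)) (hφ : IsSmoothRep E φ)

include hφ in
theorem continuous_conjRep (A : V →L[ℂ] V) : Continuous fun g : G => conjRep φ g A := by
  have h : Continuous fun g : G => (φ g : V →L[ℂ] V) := hφ.continuous
  simp only [conjRep_apply]
  fun_prop

theorem continuous_frobeniusForm {X : Type*} [TopologicalSpace X] {a b : X → V →L[ℂ] V}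
    (ha : Continuous a) (hb : Continuous b) :
    Continuous fun x => frobeniusForm V (a x) (b x) := by
  obtain ⟨L, hL⟩ := exists_continuous_bilinear (frobeniusForm V)
  have h : Continuous fun x => L (a x) (b x) := by fun_prop
  exact h.congr fun p => hL _ _

include hφ in
theorem continuous_frobeniusForm_conjRep (A B : V →L[ℂ] V) :
    Continuous fun g : G => frobeniusForm V (conjRep φ g A) B :=
  continuous_frobeniusForm (continuous_conjRep φ hφ A) continuous_const

variable [CompactSpace G] [MeasurableSpace G] [BorelSpace G]
  (μ : Measure G) [μ.IsHaarMeasure] [IsProbabilityMeasure μ]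

/-- The mean of `⟨g A g⁻¹, B⟩`, as a linear form in `B`. -/
noncomputable def firstMoment (A : V →L[ℂ] V) : (V →L[ℂ] V) →ₗ[ℝ] ℝ where
  toFun B := ∫ g, frobeniusForm V (conjRep φ g A) B ∂μ
  map_add' B B' := by
    simp only [map_add]
    exact integral_add (integrable_of_continuous μ (continuous_frobeniusForm_conjRep φ hφ A B))
      (integrable_of_continuous μ (continuous_frobeniusForm_conjRep φ hφ A B'))
  map_smul' c B := by
    simp only [map_smul]
    exact integral_smul c _

/-- The second moment of `⟨g A g⁻¹, B⟩`, as a bilinear form in `B`. -/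
noncomputable def secondMoment (A : V →L[ℂ] V) : LinearMap.BilinForm ℝ (V →L[ℂ] V) :=
  integralForm μ (fun g => (frobeniusForm V (conjRep φ g A)).smulRight
      (frobeniusForm V (conjRep φ g A)))
    (fun B B' => (continuous_frobeniusForm_conjRep φ hφ A B).mul
      (continuous_frobeniusForm_conjRep φ hφ A B'))

theorem firstMoment_apply (A B : V →L[ℂ] V) :
    firstMoment φ hφ μ A B = ∫ g, frobeniusForm V (conjRep φ g A) B ∂μ := rfl

theorem secondMoment_apply (A B B' : V →L[ℂ] V) :
    secondMoment φ hφ μ A B B' =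
      ∫ g, frobeniusForm V (conjRep φ g A) B * frobeniusForm V (conjRep φ g A) B' ∂μ := rfl

theorem integral_sum_mul_frobeniusForm {ι : Type*} [Fintype ι] (A : V →L[ℂ] V)
    (b b' : ι → V →L[ℂ] V) :
    ∫ g, ∑ i, frobeniusForm V (conjRep φ g A) (b i) * frobeniusForm V (conjRep φ g A) (b' i) ∂μ =
      ∑ i, secondMoment φ hφ μ A (b i) (b' i) := by
  have h : ∀ i, Integrable (fun g => frobeniusForm V (conjRep φ g A) (b i) *
      frobeniusForm V (conjRep φ g A) (b' i)) μ := fun i =>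
    integrable_of_continuous μ ((continuous_frobeniusForm_conjRep φ hφ A (b i)).mul
      (continuous_frobeniusForm_conjRep φ hφ A (b' i)))
  exact integral_finsetSum _ fun i _ => h i

theorem secondMoment_comm (A B B' : V →L[ℂ] V) :
    secondMoment φ hφ μ A B B' = secondMoment φ hφ μ A B' B := by
  rw [secondMoment_apply, secondMoment_apply]
  exact integral_congr_ae (Filter.Eventually.of_forall fun g => mul_comm _ _)

theorem firstMoment_lie (A : V →L[ℂ] V) (z : GroupLieAlgebra 𝓘(ℝ, E) G) (B : V →L[ℂ] V) :
    firstMoment φ hφ μ A ⁅dRep φ hφ z, B⁆ = 0 := by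
  have : IsTopologicalGroup G := topologicalGroup_of_lieGroup 𝓘(ℝ, E) ∞
  refine apply_lie_dRep_eq_zero φ hφ _ (fun k B => ?_) z B
  rw [firstMoment_apply, firstMoment_apply, ← integral_mul_left_eq_self _ k]
  simp only [frobeniusForm_conjRep_mul]

theorem secondMoment_lie (A : V →L[ℂ] V) (z : GroupLieAlgebra 𝓘(ℝ, E) G) (B B' : V →L[ℂ] V) :
    secondMoment φ hφ μ A ⁅dRep φ hφ z, B⁆ B' =
      - secondMoment φ hφ μ A B ⁅dRep φ hφ z, B'⁆ := by
  have : IsTopologicalGroup G := topologicalGroup_of_lieGroup 𝓘(ℝ, E) ∞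
  refine bilin_lie_dRep φ hφ _ (fun k B B' => ?_) z B B'
  rw [secondMoment_apply, secondMoment_apply, ← integral_mul_left_eq_self _ k]
  simp only [frobeniusForm_conjRep_mul]

variable {𝔞 : LieIdeal ℝ (GroupLieAlgebra 𝓘(ℝ, E) G)}

theorem firstMoment_eq_zero [LieAlgebra.IsSimple ℝ 𝔞] (A : V →L[ℂ] V) {B : V →L[ℂ] V}
    (hB : B ∈ dRepIdeal φ hφ 𝔞) : firstMoment φ hφ μ A B = 0 :=
  dRepIdeal_le_of_lie_mem φ hφ (LinearMap.ker (firstMoment φ hφ μ A))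
    (fun x _ _ _ => firstMoment_lie φ hφ μ A x _) hB

/-- The second moment on the image of a simple ideal. -/
theorem finrank_mul_secondMoment [ConnectedSpace G] [LieAlgebra.IsSimple ℝ 𝔞] (A : V →L[ℂ] V)
    {B B' : V →L[ℂ] V} (hB : B ∈ dRepIdeal φ hφ 𝔞) (hB' : B' ∈ dRepIdeal φ hφ 𝔞) :
    (Module.finrank ℝ 𝔞 : ℝ) * secondMoment φ hφ μ A B B' =
      frobeniusSq (frobeniusProj (dRepIdeal φ hφ 𝔞).toSubmodule A) * frobeniusForm V B B' := by
  rcases dRep_injOn_or_eq_zero φ hφ (𝔞 := 𝔞) with h | h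
  · obtain ⟨c, hc⟩ := exists_eq_mul_frobeniusForm φ hφ h (secondMoment φ hφ μ A)
      (secondMoment_comm φ hφ μ A) (secondMoment_lie φ hφ μ A)
    rw [hc B hB B' hB', ← mul_assoc]
    congr 1
    obtain ⟨b, b', hb⟩ := exists_frobenius_dual_basis (dRepIdeal φ hφ 𝔞).toSubmodule
    rw [← finrank_dRepIdeal φ hφ h]
    -- The constant `c` is found by contracting with dual bases: the Frobenius form contracts to the
    -- dimension.
    have h1 : ∑ i, secondMoment φ hφ μ A (b i) (b' i) =
        c * Module.finrank ℝ (dRepIdeal φ hφ 𝔞).toSubmodule := by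
      have h2 := sum_frobeniusForm_self b b' hb
      rw [Fintype.card_fin] at h2
      rw [← h2, Finset.mul_sum]
      exact Finset.sum_congr rfl fun i _ => hc _ (b i).2 _ (b' i).2
    rw [mul_comm, ← h1]
    rw [← integral_sum_mul_frobeniusForm φ hφ μ A (fun i => (b i : V →L[ℂ] V))
      (fun i => (b' i : V →L[ℂ] V))]
    -- Before integration the contraction is `‖P(g A g⁻¹)‖² = ‖g P(A) g⁻¹‖² = ‖P A‖²`, independent
    -- of `g`.
    have h3 : ∀ g : G, ∑ i, frobeniusForm V (conjRep φ g A) (b i) *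
        frobeniusForm V (conjRep φ g A) (b' i) =
        frobeniusSq (frobeniusProj (dRepIdeal φ hφ 𝔞).toSubmodule A) := by
      intro g
      have hP := frobeniusProj_conjRep φ hφ (dRepIdeal φ hφ 𝔞).toSubmodule
        (fun z B hB => lie_dRep_mem_dRepIdeal φ hφ z hB) g A
      have h4 := sum_frobeniusForm_mul b b' hb
        (frobeniusProj (dRepIdeal φ hφ 𝔞).toSubmodule (conjRep φ g A)) _
        (frobeniusProj_mem _ (conjRep φ g A))
      rw [frobeniusSq, ← frobeniusForm_conjRep φ g, ← hP, ← h4]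
      refine Finset.sum_congr rfl fun i _ => ?_
      rw [frobeniusForm_frobeniusProj _ _ _ (b' i).2,
        frobeniusForm_frobeniusProj_left _ _ _ (b i).2, frobeniusForm_comm (b' i : V →L[ℂ] V)]
    refine (integral_congr_ae (Filter.Eventually.of_forall h3)).trans ?_
    simp only [integral_const, probReal_univ, one_smul]
  -- A trivially represented ideal has zero image, so both sides vanish although `finrank ℝ 𝔞` is
  -- not the dimension of the image.
  · obtain ⟨x, hx, rfl⟩ := (mem_dRepIdeal φ hφ).1 hB
    simp [h x hx]

/-- The second moment of `[X, g A g⁻¹]` for `X` in the image of a simple ideal. -/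
theorem finrank_mul_integral_frobeniusSq_lie [ConnectedSpace G] [LieAlgebra.IsSimple ℝ 𝔞]
    (A : V →L[ℂ] V) (X : dRepIdeal φ hφ 𝔞) :
    (Module.finrank ℝ 𝔞 : ℝ) * ∫ g, frobeniusSq ⁅(X : V →L[ℂ] V),
        frobeniusProj (dRepIdeal φ hφ 𝔞).toSubmodule (conjRep φ g⁻¹ A)⁆ ∂μ =
      killingSq (dRepIdeal φ hφ 𝔞) X *
        frobeniusSq (frobeniusProj (dRepIdeal φ hφ 𝔞).toSubmodule A) := by
  have : IsTopologicalGroup G := topologicalGroup_of_lieGroup 𝓘(ℝ, E) ∞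
  have := isInvInvariant_of_compactSpace μ
  rw [integral_inv_eq_self (fun g => frobeniusSq ⁅(X : V →L[ℂ] V),
        frobeniusProj (dRepIdeal φ hφ 𝔞).toSubmodule (conjRep φ g A)⁆) μ]
  obtain ⟨b, b', hb⟩ := exists_frobenius_dual_basis (dRepIdeal φ hφ 𝔞).toSubmodule
  obtain ⟨x, hx, hxX⟩ := (mem_dRepIdeal φ hφ).1 X.2
  have hlie : ∀ A A', frobeniusForm V ⁅(X : V →L[ℂ] V), A⁆ A' =
      - frobeniusForm V A ⁅(X : V →L[ℂ] V), A'⁆ := by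
    rw [← hxX]; exact frobeniusForm_lie_dRep φ hφ x
  have hmem : ∀ {A}, A ∈ dRepIdeal φ hφ 𝔞 → ⁅(X : V →L[ℂ] V), A⁆ ∈ dRepIdeal φ hφ 𝔞 := by
    rw [← hxX]; exact lie_dRep_mem_dRepIdeal φ hφ x
  -- Parseval in dual bases. Skewness moves `ad X` from `g A g⁻¹` onto the basis vectors, leaving
  -- products whose integrals are second moments.
  have h1 : ∀ g : G, frobeniusSq ⁅(X : V →L[ℂ] V),
        frobeniusProj (dRepIdeal φ hφ 𝔞).toSubmodule (conjRep φ g A)⁆ =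
      ∑ i, frobeniusForm V (conjRep φ g A) ⁅(X : V →L[ℂ] V), (b i : V →L[ℂ] V)⁆ *
        frobeniusForm V (conjRep φ g A) ⁅(X : V →L[ℂ] V), (b' i : V →L[ℂ] V)⁆ := by
    intro g
    have h2 := frobeniusProj_mem (dRepIdeal φ hφ 𝔞).toSubmodule (conjRep φ g A)
    rw [frobeniusSq, ← sum_frobeniusForm_mul b b' hb _ _ (hmem h2)]
    refine Finset.sum_congr rfl fun i _ => ?_
    rw [hlie, frobeniusForm_comm (b' i : V →L[ℂ] V), hlie, neg_mul_neg,
      frobeniusForm_frobeniusProj_left _ _ _ (hmem (b i).2),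
      frobeniusForm_frobeniusProj_left _ _ _ (hmem (b' i).2)]
  simp only [h1]
  rw [integral_sum_mul_frobeniusForm φ hφ μ A (fun i => ⁅(X : V →L[ℂ] V), (b i : V →L[ℂ] V)⁆)
    (fun i => ⁅(X : V →L[ℂ] V), (b' i : V →L[ℂ] V)⁆), Finset.mul_sum, Finset.sum_congr rfl fun i _ =>
    finrank_mul_secondMoment φ hφ μ A (hmem (b i).2) (hmem (b' i).2), ← Finset.mul_sum, mul_comm]
  congr 1
  -- What remains is `∑ ⟨[X, b i], [X, b' i]⟩ = -∑ ⟨b' i, [X, [X, b i]]⟩`, minus the trace of `ad X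
  -- ∘ ad X`.
  have h3 := trace_eq_sum_frobeniusForm b b' hb
    (LieAlgebra.ad ℝ (dRepIdeal φ hφ 𝔞) X ∘ₗ LieAlgebra.ad ℝ (dRepIdeal φ hφ 𝔞) X)
  rw [killingSq, killingForm_apply_apply]
  refine Eq.trans ?_ (congrArg Neg.neg h3).symm
  rw [← Finset.sum_neg_distrib]
  refine Finset.sum_congr rfl fun i _ => ?_
  rw [frobeniusForm_comm, hlie]
  rfl

end Moments

/-! ### Elementary consequences of a reductive decomposition -/

section ReductiveDecomposition

variable {𝔤 : Type*} [LieRing 𝔤] [LieAlgebra ℝ 𝔤] {n : ℕ} {𝔞 : Fin n → LieIdeal ℝ 𝔤}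

theorem IsReductiveDecomposition.lie_eq_zero (hd : IsReductiveDecomposition 𝔞) {α β : Fin n}
    (h : α ≠ β) : ∀ x ∈ 𝔞 α, ∀ y ∈ 𝔞 β, ⁅x, y⁆ = 0 := by
  intro x hx y hy
  have h1 := hd.directSum.submodule_iSupIndep.pairwiseDisjoint
    (show some α ≠ some β from fun he => h (Option.some.inj he))
  refine (Submodule.disjoint_def.1 h1) _ ?_ ?_
  · exact lie_mem_left ℝ 𝔤 (𝔞 α) x y hx
  · exact lie_mem_right ℝ 𝔤 (𝔞 β) x y hy

theorem lie_center_eq_zero (x : 𝔤) {y : 𝔤} (hy : y ∈ LieAlgebra.center ℝ 𝔤) : ⁅x, y⁆ = 0 :=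
  (LieModule.mem_maxTrivSubmodule (R := ℝ) (L := 𝔤) (M := 𝔤) y).1 hy x

theorem IsReductiveDecomposition.exists_sum (hd : IsReductiveDecomposition 𝔞) (x : 𝔤) :
    ∃ (u : Fin n → 𝔤) (c : 𝔤), (∀ α, u α ∈ 𝔞 α) ∧ c ∈ LieAlgebra.center ℝ 𝔤 ∧
      x = ∑ α, u α + c := by
  have h1 : x ∈ ⨆ j : Option (Fin n), ⨆ _ : j ∈ Finset.univ,
      (j.elim (LieAlgebra.center ℝ 𝔤).toSubmodule fun α => (𝔞 α).toSubmodule : Submodule ℝ 𝔤) := by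
    simp only [Finset.mem_univ, iSup_pos]
    rw [hd.directSum.submodule_iSup_eq_top]
    trivial
  rw [Submodule.mem_iSup_finset_iff_exists_sum] at h1
  obtain ⟨v, rfl⟩ := h1
  refine ⟨fun α => v (some α), v none, fun α => (v (some α)).2, (v none).2, ?_⟩
  rw [Fintype.sum_option, add_comm]

end ReductiveDecomposition

/-! ### The gradient as a real Frobenius pairing -/

section Gradient

variable {V : Type*} [NormedAddCommGroup V] [InnerProductSpace ℂ V] [FiniteDimensional ℂ V]
  {G : Type*} [Group G] (φ : G →* unitary (V →L[ℂ] V))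

/-- Symmetry of the real form, applied to `-iP` and `Q`, equates the imaginary part with its
negative. -/
theorem tr_mul_im_eq_zero (P Q : V →L[ℂ] V) (hP : star P = P) (hQ : star Q = Q) :
    (tr (P * Q)).im = 0 := by
  have h := frobeniusForm_comm (-Complex.I • P) Q
  rw [frobeniusForm_apply, frobeniusForm_apply, star_smul, hP, hQ, mul_smul_comm, smul_mul_assoc,
    tr_smul, tr_smul, tr_mul_comm Q P] at h
  simp at h
  linarith

theorem star_lie_of_star_eq (H A : V →L[ℂ] V) (hH : star H = -H) (hA : star A = A) :
    star ⁅H, A⁆ = ⁅H, A⁆ := by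
  rw [LieRing.of_associative_ring_bracket, star_sub, star_mul, star_mul, hH, hA]
  noncomm_ring

theorem star_conj (A u : V →L[ℂ] V) (hA : star A = A) : star (u * A * star u) = u * A * star u := by
  rw [star_mul, star_mul, star_star, hA, mul_assoc]

theorem absGradient_im (H O ρ : V →L[ℂ] V) (hH : star H = -H) (hO : star O = O)
    (hρ : star ρ = ρ) (gp gm : G) : (absGradient φ H O ρ gp gm).im = 0 := by
  refine tr_mul_im_eq_zero _ _ ?_ (star_lie_of_star_eq _ _ hH (star_conj _ _ hO))
  have := star_conj ρ (star (φ gm : V →L[ℂ] V)) hρ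
  rwa [star_star] at this

/-- The two factors `i` cancel because `star (i ρ) = -i ρ`; this trades Hermitian operators for
skew-Hermitian ones. -/
theorem absGradient_re (H O ρ : V →L[ℂ] V) (hρ : star ρ = ρ) (gp gm : G) :
    (absGradient φ H O ρ gp gm).re = frobeniusForm V (conjRep φ gm⁻¹ (Complex.I • ρ))
      ⁅H, conjRep φ gp (Complex.I • O)⁆ := by
  have h1 := star_conj ρ (star (φ gm : V →L[ℂ] V)) hρ
  rw [star_star] at h1
  rw [conjRep_inv_apply, conjRep_apply, absGradient, frobeniusForm_apply]
  simp only [mul_smul_comm, smul_mul_assoc, star_smul, h1, LieRing.of_associative_ring_bracket,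
    ← smul_sub]
  rw [smul_smul]
  simp

end Gradient

/-! ### Splitting the gradient along the simple ideals -/

section Variance

variable {E : Type*} [NormedAddCommGroup E] [NormedSpace ℝ E] [FiniteDimensional ℝ E]
  {G : Type*} [TopologicalSpace G] [ChartedSpace E G] [Group G] [LieGroup 𝓘(ℝ, E) ∞ G]
  {V : Type*} [NormedAddCommGroup V] [InnerProductSpace ℂ V] [FiniteDimensional ℂ V]
  (φ : G →* unitary (V →L[ℂ] V)) (hφ : IsSmoothRep E φ)
  {n : ℕ} {𝔞 : Fin n → LieIdeal ℝ (GroupLieAlgebra 𝓘(ℝ, E) G)}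

theorem frobeniusForm_dRepIdeal_eq_zero (hd : IsReductiveDecomposition 𝔞) {α β : Fin n}
    (h : α ≠ β) {A B : V →L[ℂ] V} (hA : A ∈ dRepIdeal φ hφ (𝔞 α))
    (hB : B ∈ dRepIdeal φ hφ (𝔞 β)) : frobeniusForm V A B = 0 :=
  have := hd.simple α
  bilin_eq_zero_of_lie_eq_zero φ hφ _ (frobeniusForm_lie_dRep φ hφ) (hd.lie_eq_zero h) hA hB

theorem frobeniusForm_dRepIdeal_center_eq_zero (hd : IsReductiveDecomposition 𝔞) {α : Fin n}
    {A B : V →L[ℂ] V} (hA : A ∈ dRepIdeal φ hφ (𝔞 α))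
    (hB : B ∈ dRepIdeal φ hφ (LieAlgebra.center ℝ (GroupLieAlgebra 𝓘(ℝ, E) G))) :
    frobeniusForm V A B = 0 :=
  have := hd.simple α
  bilin_eq_zero_of_lie_eq_zero φ hφ _ (frobeniusForm_lie_dRep φ hφ)
    (fun x _ _ hy => lie_center_eq_zero x hy) hA hB

theorem frobeniusProj_dRepIdeal_center (hd : IsReductiveDecomposition 𝔞) (α : Fin n)
    {B : V →L[ℂ] V}
    (hB : B ∈ dRepIdeal φ hφ (LieAlgebra.center ℝ (GroupLieAlgebra 𝓘(ℝ, E) G))) :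
    frobeniusProj (dRepIdeal φ hφ (𝔞 α)).toSubmodule B = 0 :=
  frobeniusProj_eq_zero _ _ fun _ hC => frobeniusForm_dRepIdeal_center_eq_zero φ hφ hd hC hB

/-- The image of a simple ideal is Frobenius-orthogonal to those of the other summands, so the
projection reads off one component. -/
theorem frobeniusProj_dRep_sum (hd : IsReductiveDecomposition 𝔞)
    (u : Fin n → GroupLieAlgebra 𝓘(ℝ, E) G) (c : GroupLieAlgebra 𝓘(ℝ, E) G)
    (hu : ∀ α, u α ∈ 𝔞 α) (hc : c ∈ LieAlgebra.center ℝ (GroupLieAlgebra 𝓘(ℝ, E) G))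
    (α : Fin n) :
    frobeniusProj (dRepIdeal φ hφ (𝔞 α)).toSubmodule (dRep φ hφ (∑ β, u β + c)) =
      dRep φ hφ (u α) := by
  refine frobeniusProj_eq _ _ _ (dRep_mem_dRepIdeal φ hφ (hu α)) fun C hC => ?_
  rw [map_sub, map_add, map_add,
    frobeniusForm_dRepIdeal_center_eq_zero φ hφ hd hC (dRep_mem_dRepIdeal φ hφ hc), add_zero,
    map_sum, map_sum, Finset.sum_eq_single α, sub_self]
  · intro β _ hβ
    exact frobeniusForm_dRepIdeal_eq_zero φ hφ hd hβ.symm hC (dRep_mem_dRepIdeal φ hφ (hu β))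
  · simp

/-- The central component of `h` disappears because the second entry lies in `dφ(𝔤)`; it need not
commute with a general operator. -/
theorem lie_dRep_eq_sum (hd : IsReductiveDecomposition 𝔞) (h x : GroupLieAlgebra 𝓘(ℝ, E) G) :
    ⁅dRep φ hφ h, dRep φ hφ x⁆ =
      ∑ α, ⁅frobeniusProj (dRepIdeal φ hφ (𝔞 α)).toSubmodule (dRep φ hφ h), dRep φ hφ x⁆ := by
  obtain ⟨u, c, hu, hc, rfl⟩ := hd.exists_sum h
  simp only [frobeniusProj_dRep_sum φ hφ hd u c hu hc]
  have h1 : ⁅dRep φ hφ c, dRep φ hφ x⁆ = 0 := by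
    rw [← LieHom.map_lie, ← lie_skew, lie_center_eq_zero x hc]
    simp
  rw [map_add, add_lie, h1, add_zero, map_sum, sum_lie]

/-- Apply `frobeniusProj_conjRep` to the subspace `dφ(𝔤)` itself: an operator fixed by the
projection has all its conjugates fixed. -/
theorem conjRep_dRep_mem_range [ConnectedSpace G] (g : G) (o : GroupLieAlgebra 𝓘(ℝ, E) G) :
    ∃ x, dRep φ hφ x = conjRep φ g (dRep φ hφ o) := by
  have h1 := frobeniusProj_conjRep φ hφ (LinearMap.range (dRep φ hφ).toLinearMap)
    (fun z B hB => by
      obtain ⟨x, rfl⟩ := hB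
      exact ⟨⁅z, x⁆, LieHom.map_lie _ _ _⟩) g (dRep φ hφ o)
  rw [frobeniusProj_of_mem (LinearMap.range (dRep φ hφ).toLinearMap) (dRep φ hφ o)
    (LinearMap.mem_range_self (dRep φ hφ).toLinearMap o)] at h1
  have h2 := frobeniusProj_mem (LinearMap.range (dRep φ hφ).toLinearMap)
    (conjRep φ g (dRep φ hφ o))
  rw [h1] at h2
  exact h2

/-- The abstracted gradient is the sum of its contributions from the simple ideals. -/
theorem frobeniusForm_lie_conjRep_eq_sum [ConnectedSpace G] (hd : IsReductiveDecomposition 𝔞)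
    (h o : GroupLieAlgebra 𝓘(ℝ, E) G) (R : V →L[ℂ] V) (gp gm : G) :
    frobeniusForm V (conjRep φ gm⁻¹ R) ⁅dRep φ hφ h, conjRep φ gp (dRep φ hφ o)⁆ =
      frobeniusForm V (conjRep φ gp (dRep φ hφ o)) (-∑ α,
        ⁅frobeniusProj (dRepIdeal φ hφ (𝔞 α)).toSubmodule (dRep φ hφ h),
          frobeniusProj (dRepIdeal φ hφ (𝔞 α)).toSubmodule (conjRep φ gm⁻¹ R)⁆) := by
  obtain ⟨x, hx⟩ := conjRep_dRep_mem_range φ hφ gp o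
  rw [← hx, lie_dRep_eq_sum φ hφ hd h x, map_neg, map_sum, map_sum, ← Finset.sum_neg_distrib]
  refine Finset.sum_congr rfl fun α _ => ?_
  obtain ⟨y, hy, hyH⟩ := (mem_dRepIdeal φ hφ).1
    (frobeniusProj_mem (dRepIdeal φ hφ (𝔞 α)).toSubmodule (dRep φ hφ h))
  rw [← hyH, frobeniusForm_comm (dRep φ hφ x), frobeniusForm_lie_dRep φ hφ, neg_neg]
  -- The projection of the other entry costs nothing, since `[H_α, dφ(x)]` already lies in
  -- `dφ(𝔤_α)`.
  refine (frobeniusForm_frobeniusProj_left _ _ _ ?_).symm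
  rw [← LieHom.map_lie]
  exact dRep_mem_dRepIdeal φ hφ (lie_mem_left ℝ _ _ _ _ hy)

variable [CompactSpace G] [MeasurableSpace G] [BorelSpace G]
  (μ : Measure G) [μ.IsHaarMeasure] [IsProbabilityMeasure μ]

theorem secondMoment_sum [ConnectedSpace G] (hd : IsReductiveDecomposition 𝔞) (A : V →L[ℂ] V)
    (Z : Fin n → V →L[ℂ] V) (hZ : ∀ α, Z α ∈ dRepIdeal φ hφ (𝔞 α)) :
    secondMoment φ hφ μ A (∑ α, Z α) (∑ α, Z α) =
      ∑ α, frobeniusSq (frobeniusProj (dRepIdeal φ hφ (𝔞 α)).toSubmodule A) /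
        (Module.finrank ℝ (𝔞 α) : ℝ) * frobeniusSq (Z α) := by
  simp only [map_sum, LinearMap.sum_apply]
  refine Finset.sum_congr rfl fun α _ => ?_
  have := hd.simple α
  rw [Finset.sum_eq_single α]
  · have h1 := finrank_mul_secondMoment φ hφ μ A (hZ α) (hZ α)
    have h2 : (Module.finrank ℝ (𝔞 α) : ℝ) ≠ 0 := by
      have : Nontrivial (𝔞 α) := LieAlgebra.IsSimple.nontrivial ℝ (𝔞 α)
      exact_mod_cast (Module.finrank_pos (R := ℝ) (M := 𝔞 α)).ne'
    rw [frobeniusSq, frobeniusSq] at *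
    field_simp
    rw [mul_comm, h1]
  · intro β _ hβ
    have := hd.simple β
    exact bilin_eq_zero_of_lie_eq_zero φ hφ _ (secondMoment_lie φ hφ μ A) (hd.lie_eq_zero hβ)
      (hZ β) (hZ α)
  · simp

end Variance

/-! ### The variance formula -/

section VarianceFormula

variable {E : Type*} [NormedAddCommGroup E] [NormedSpace ℝ E] [FiniteDimensional ℝ E]
  {G : Type*} [TopologicalSpace G] [ChartedSpace E G] [Group G] [LieGroup 𝓘(ℝ, E) ∞ G]
  {V : Type*} [NormedAddCommGroup V] [InnerProductSpace ℂ V] [FiniteDimensional ℂ V]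
  (φ : G →* unitary (V →L[ℂ] V)) (hφ : IsSmoothRep E φ)
  {n : ℕ} {𝔞 : Fin n → LieIdeal ℝ (GroupLieAlgebra 𝓘(ℝ, E) G)}

theorem frobeniusSq_hermPart (𝔴 : LieSubalgebra ℝ (V →L[ℂ] V)) (A : V →L[ℂ] V) :
    frobeniusSq (hermPart 𝔴 A) = frobeniusSq (frobeniusProj 𝔴.toSubmodule (Complex.I • A)) := by
  rw [frobeniusSq, frobeniusSq, hermPart, frobeniusForm_apply, frobeniusForm_apply, star_smul,
    smul_mul_smul_comm]
  simp

theorem frobeniusSq_neg (A : V →L[ℂ] V) : frobeniusSq (-A) = frobeniusSq A := by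
  simp [frobeniusSq]

theorem continuous_frobeniusSq {X : Type*} [TopologicalSpace X] {a : X → V →L[ℂ] V}
    (ha : Continuous a) : Continuous fun x => frobeniusSq (a x) :=
  continuous_frobeniusForm ha ha

include hφ in
theorem continuous_lie_frobeniusProj_conjRep (W : Submodule ℝ (V →L[ℂ] V)) (X R : V →L[ℂ] V) :
    Continuous fun g : G => ⁅X, frobeniusProj W (conjRep φ g⁻¹ R)⁆ := by
  have : IsTopologicalGroup G := topologicalGroup_of_lieGroup 𝓘(ℝ, E) ∞
  have h1 : Continuous fun g : G => conjRep φ g⁻¹ R :=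
    (continuous_conjRep φ hφ R).comp continuous_inv
  have h2 : Continuous (frobeniusProj W) := LinearMap.continuous_of_finiteDimensional _
  have h3 : Continuous fun g : G => frobeniusProj W (conjRep φ g⁻¹ R) := h2.comp h1
  simp only [LieRing.of_associative_ring_bracket]
  fun_prop

variable [CompactSpace G] [ConnectedSpace G] [MeasurableSpace G] [BorelSpace G]
  (μ : Measure G) [μ.IsHaarMeasure] [IsProbabilityMeasure μ]

/-- The variance formula, for an arbitrary Hermitian operator in the place of the density
operator. -/
theorem gradVar_eq_sum (hd : IsReductiveDecomposition 𝔞) (h o : GroupLieAlgebra 𝓘(ℝ, E) G)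
    (O H ρ : V →L[ℂ] V) (hO : Complex.I • O = dRep φ hφ o) (hH : H = dRep φ hφ h)
    (hρ : star ρ = ρ) :
    gradVar μ φ H O ρ =
      ∑ α, killingSq (dRepIdeal φ hφ (𝔞 α)) (skewPart (dRepIdeal φ hφ (𝔞 α)) H) *
        frobeniusSq (hermPart (dRepIdeal φ hφ (𝔞 α)) O) *
        frobeniusSq (hermPart (dRepIdeal φ hφ (𝔞 α)) ρ) / (Module.finrank ℝ (𝔞 α) : ℝ) ^ 2 := by
  -- This makes the product σ-algebra on `G × G` the Borel one, so continuous functions there are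
  -- integrable.
  have : SecondCountableTopology G := ChartedSpace.secondCountable_of_sigmaCompact E G
  let K : Fin n → Submodule ℝ (V →L[ℂ] V) := fun α => (dRepIdeal φ hφ (𝔞 α)).toSubmodule
  let Z : Fin n → G → V →L[ℂ] V := fun α g =>
    -⁅frobeniusProj (K α) H, frobeniusProj (K α) (conjRep φ g⁻¹ (Complex.I • ρ))⁆
  have hZ : ∀ α g, Z α g ∈ dRepIdeal φ hφ (𝔞 α) := fun α g =>
    neg_mem ((dRepIdeal φ hφ (𝔞 α)).lie_mem (frobeniusProj_mem _ _) (frobeniusProj_mem _ _))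
  have hZc : ∀ α, Continuous (Z α) := fun α =>
    (continuous_lie_frobeniusProj_conjRep φ hφ (K α) _ _).neg
  let f : G × G → ℝ := fun p =>
    frobeniusForm V (conjRep φ p.1 (Complex.I • O)) (∑ α, Z α p.2)
  have hf : (fun p : G × G => (absGradient φ H O ρ p.1 p.2).re) = f := by
    funext p
    rw [absGradient_re φ H O ρ hρ, hH, hO, frobeniusForm_lie_conjRep_eq_sum φ hφ hd h o]
    simp only [f, Z, K, Finset.sum_neg_distrib, hH, hO]
  have hfc : Continuous f := by
    have h1 : Continuous fun p : G × G => ∑ α, Z α p.2 :=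
      continuous_finsetSum _ fun α _ => (hZc α).comp continuous_snd
    exact continuous_frobeniusForm
      ((continuous_conjRep φ hφ (Complex.I • O)).comp continuous_fst) h1
  -- The inner integral is over `g⁺` with `g⁻` fixed: a first moment of `iO`, evaluated on elements
  -- of simple ideals.
  have hmean : ∫ p, f p ∂(μ.prod μ) = 0 := by
    rw [integral_prod_symm _ (integrable_of_continuous _ hfc)]
    have h1 : ∀ g, ∫ k, f (k, g) ∂μ = 0 := by
      intro g
      have h2 : ∫ k, f (k, g) ∂μ = firstMoment φ hφ μ (Complex.I • O) (∑ α, Z α g) := rfl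
      rw [h2, map_sum]
      refine Finset.sum_eq_zero fun α _ => ?_
      have := hd.simple α
      exact firstMoment_eq_zero φ hφ μ _ (hZ α g)
    simp only [h1, integral_zero]
  have hsq : ∀ g, ∫ k, f (k, g) ^ 2 ∂μ =
      ∑ α, frobeniusSq (frobeniusProj (K α) (Complex.I • O)) /
        (Module.finrank ℝ (𝔞 α) : ℝ) * frobeniusSq (Z α g) := by
    intro g
    rw [← secondMoment_sum φ hφ μ hd _ (fun α => Z α g) (fun α => hZ α g), secondMoment_apply]
    simp only [f, sq]
  -- The remaining average over `g⁻` yields the Killing norm and the second factor `1 / d_α`.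
  have hint : ∀ α, (Module.finrank ℝ (𝔞 α) : ℝ) * ∫ g, frobeniusSq (Z α g) ∂μ =
      killingSq (dRepIdeal φ hφ (𝔞 α)) (skewPart (dRepIdeal φ hφ (𝔞 α)) H) *
        frobeniusSq (frobeniusProj (K α) (Complex.I • ρ)) := by
    intro α
    have := hd.simple α
    have h1 := finrank_mul_integral_frobeniusSq_lie φ hφ μ (Complex.I • ρ)
      (skewPart (dRepIdeal φ hφ (𝔞 α)) H)
    simp only [Z, frobeniusSq_neg]
    exact h1
  rw [gradVar, hf, variance_eq_sub
    (hfc.memLp_of_hasCompactSupport (HasCompactSupport.of_compactSpace f))]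
  rw [hmean, zero_pow two_ne_zero, sub_zero]
  rw [integral_prod_symm _ (integrable_of_continuous _ (hfc.pow 2))]
  simp only [Pi.pow_apply, hsq]
  rw [integral_finsetSum _ fun α _ => (integrable_of_continuous μ
    (continuous_frobeniusSq (hZc α))).const_mul _]
  refine Finset.sum_congr rfl fun α _ => ?_
  rw [integral_const_mul, frobeniusSq_hermPart, frobeniusSq_hermPart]
  have hne : (Module.finrank ℝ (𝔞 α) : ℝ) ≠ 0 := by
    have := hd.simple α
    have : Nontrivial (𝔞 α) := LieAlgebra.IsSimple.nontrivial ℝ (𝔞 α)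
    exact_mod_cast (Module.finrank_pos (R := ℝ) (M := 𝔞 α)).ne'
  have hdiv : ∀ {a c k m d : ℝ}, d ≠ 0 → d * m = k * c → a / d * m = k * a * c / d ^ 2 := by
    intro a c k m d hd0 hm
    rw [mul_right_comm, ← hm]
    field_simp
  exact hdiv hne (hint α)

end VarianceFormula

end LieGradient

/-! ### The theorem -/

theorem theorem3
    {E : Type*} [NormedAddCommGroup E] [NormedSpace ℝ E] [FiniteDimensional ℝ E]
    {G : Type*} [TopologicalSpace G] [ChartedSpace E G] [Group G] [LieGroup 𝓘(ℝ, E) ∞ G]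
    [T2Space G] [CompactSpace G] [ConnectedSpace G]
    [MeasurableSpace G] [BorelSpace G]
    (μ : Measure G) [μ.IsHaarMeasure] [IsProbabilityMeasure μ]
    {V : Type*} [NormedAddCommGroup V] [InnerProductSpace ℂ V] [FiniteDimensional ℂ V]
    (φ : G →* unitary (V →L[ℂ] V)) (hφ : IsSmoothRep E φ)
    (o h : GroupLieAlgebra 𝓘(ℝ, E) G) (O H ρ : V →L[ℂ] V)
    (hO : Complex.I • O = dRep φ hφ o) (hH : H = dRep φ hφ h) (hρ : IsDensityOperator ρ) :
    -- the Lie algebra of `G` is the direct sum of simple ideals and its center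
    (∃ (n : ℕ) (𝔞 : Fin n → LieIdeal ℝ (GroupLieAlgebra 𝓘(ℝ, E) G)),
      IsReductiveDecomposition 𝔞) ∧
    -- the abstracted gradient is real
    (∀ gp gm : G, (absGradient φ H O ρ gp gm).im = 0) ∧
    -- the variance formula, for every such decomposition
    (∀ (n : ℕ) (𝔞 : Fin n → LieIdeal ℝ (GroupLieAlgebra 𝓘(ℝ, E) G)),
      IsReductiveDecomposition 𝔞 →
      gradVar μ φ H O ρ =
        ∑ α, killingSq (dRepIdeal φ hφ (𝔞 α)) (skewPart (dRepIdeal φ hφ (𝔞 α)) H) *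
          frobeniusSq (hermPart (dRepIdeal φ hφ (𝔞 α)) O) *
          frobeniusSq (hermPart (dRepIdeal φ hφ (𝔞 α)) ρ) /
          (Module.finrank ℝ (𝔞 α) : ℝ) ^ 2) ∧
    -- components along the center do not affect the variance
    (∀ Hc Oc ρc : V →L[ℂ] V,
      Hc ∈ dRepIdeal φ hφ (LieAlgebra.center ℝ (GroupLieAlgebra 𝓘(ℝ, E) G)) →
      Complex.I • Oc ∈ dRepIdeal φ hφ (LieAlgebra.center ℝ (GroupLieAlgebra 𝓘(ℝ, E) G)) →
      Complex.I • ρc ∈ dRepIdeal φ hφ (LieAlgebra.center ℝ (GroupLieAlgebra 𝓘(ℝ, E) G)) →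
      gradVar μ φ (H + Hc) (O + Oc) (ρ + ρc) = gradVar μ φ H O ρ) := by
  have hHs : star H = -H := by rw [hH, star_dRep]
  have hOs : star O = O := by
    have h1 := star_dRep φ hφ o
    rw [← hO, star_smul, ← smul_neg] at h1
    simpa using h1
  have hρs : star ρ = ρ := hρ.1.isSelfAdjoint
  obtain ⟨Φ, hΦs, hΦp, hΦi⟩ := exists_invariant_form (E := E) μ
  obtain ⟨n, 𝔞, hd⟩ := exists_isReductiveDecomposition Φ hΦs hΦp hΦi
  refine ⟨⟨n, 𝔞, hd⟩, absGradient_im φ H O ρ hHs hOs hρs,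
    fun m 𝔟 h𝔟 => gradVar_eq_sum φ hφ μ h𝔟 h o O H ρ hO hH hρs, ?_⟩
  intro Hc Oc ρc hHc hOc hρc
  obtain ⟨hc, -, hc'⟩ := (mem_dRepIdeal φ hφ).1 hHc
  obtain ⟨oc, -, hoc'⟩ := (mem_dRepIdeal φ hφ).1 hOc
  obtain ⟨rc, -, hrc'⟩ := (mem_dRepIdeal φ hφ).1 hρc
  have hρcs : star (ρ + ρc) = ρ + ρc := by
    have h1 := star_dRep φ hφ rc
    rw [hrc', star_smul, ← smul_neg] at h1
    have h2 : star ρc = ρc := by simpa using h1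
    rw [star_add, hρs, h2]
  -- The formula applies to both triples: `ρ + ρc` need not be a density operator, but it is
  -- Hermitian, and the shifted `H` and `iO` remain in `dφ(𝔤)`.
  rw [gradVar_eq_sum φ hφ μ hd h o O H ρ hO hH hρs,
    gradVar_eq_sum φ hφ μ hd (h + hc) (o + oc) (O + Oc) (H + Hc) (ρ + ρc)
      (by rw [smul_add, hO, map_add, hoc']) (by rw [hH, map_add, hc']) hρcs]
  refine Finset.sum_congr rfl fun α _ => ?_
  have h1 : skewPart (dRepIdeal φ hφ (𝔞 α)) (H + Hc) = skewPart (dRepIdeal φ hφ (𝔞 α)) H := by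
    apply Subtype.ext
    simp only [skewPart]
    rw [map_add, frobeniusProj_dRepIdeal_center φ hφ hd α hHc, add_zero]
  have h2 : ∀ A B : V →L[ℂ] V, Complex.I • B ∈
      dRepIdeal φ hφ (LieAlgebra.center ℝ (GroupLieAlgebra 𝓘(ℝ, E) G)) →
      hermPart (dRepIdeal φ hφ (𝔞 α)) (A + B) = hermPart (dRepIdeal φ hφ (𝔞 α)) A := by
    intro A B hB
    rw [hermPart, hermPart, smul_add, map_add, frobeniusProj_dRepIdeal_center φ hφ hd α hB,
      add_zero]
  rw [h1, h2 O Oc hOc, h2 ρ ρc hρc]
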